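/- Let $(X_{ij})_{(i,j)\in\mathbb{Z}^2}$ be real random variables on a probability space $(\Omega,\mathcal{F},\mathbb{P})$ with $\mathbb{E}(X_{ij})=0$ and $\mathbb{E}(X_{ij}^2)=\sigma_{ij}^2<\infty$. Let $(Y_{ij})_{i,j\ge 1}$ be independent real Gaussian random variables on the same probability space, with $\mathbb{E}(Y_{ij})=0$ and $\mathbb{E}(Y_{ij}^2)=\sigma_{ij}^2$, such that the family $(Y_{ij})$ is independent of the family $(X_{ij})$. Let $\mathbf{X}_n$ be the symmetric $n\times n$ matrix with $(\mathbf{X}_n)_{ij}=X_{ij}$ for $i\ge j$ and $(\mathbf{X}_n)_{ij}=X_{ji}$ for $i<j$; put $\mathbb{X}_n=n^{-1/2}\mathbf{X}_n$ and let $F^{\mathbb{X}_n}(t)=\frac1n\#\{k:\lambda_k\le t\}$, where $\lambda_1\le\dots\le\lambda_n$ are the eigenvalues of $\mathbb{X}_n$ counted with multiplicity. Define $\mathbb{Y}_n$ and $F^{\mathbb{Y}_n}$ in the same way from $(Y_{ij})$. Write $(u,v)\le_{\mathrm{lex}}(i,j)$ if $u<i$, or $u=i$ and $v\le j$. For an integer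 $a\ge0$ and $i\ge j$ let $\mathcal{F}_{ij}^a$ be the $\sigma$-algebra generated by all $X_{uv}$, $(u,v)\in\mathbb{Z}^2$, with $v\le u$, $(u,v)\le_{\mathrm{lex}}(i,j)$ and $\max(|u-i|,|v-j|)\ge a$. Assume: 1. $\mathbb{E}(X_{ij}\mid\mathcal{F}_{ij}^1)=0$ a.s. for all $1\le j\le i$; 2. $\sup_{n}\frac1{n^2}\sum_{1\le j\le i\le n}\sigma_{ij}^2<\infty$; 3. $\lim_{a\to\infty}\limsup_{n\to\infty}\frac1{n^2}\sum_{1\le j\le i\le n}\mathbb{E}\bigl|\mathbb{E}(X_{ij}^2-\sigma_{ij}^2\mid\mathcal{F}_{ij}^a)\bigr|=0$; 4. for every $\varepsilon>0$, $\frac1{n^2}\sum_{1\le j\le i\le n}\mathbb{E}\bigl(X_{ij}^2\,\mathbf{1}_{\{|X_{ij}|>\varepsilon n^{1/2}\}}\bigr)\to0$ as $n\to\infty$. For distribution functions $G,H$ on $\mathbb{R}$ let $d(G,H)=\inf\{\varepsilon>0: G(x-\varepsilon)-\varepsilon\le H(x)\le G(x+\varepsilon)+\varepsilon\ \text{for all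 }x\in\mathbb{R}\}$ be the Lévy distance. Let $F$ be a nonrandom distribution function on $\mathbb{R}$ (of a probability measure). If for every $\epsilon>0$ $$\lim_{n\to\infty}\mathbb{P}\bigl(d(F^{\mathbb{Y}_n},F)>\epsilon\bigr)=0,$$ then for every $\epsilon>0$ $$\lim_{n\to\infty}\mathbb{P}\bigl(d(F^{\mathbb{X}_n},F)>\epsilon\bigr)=0.$$ -/

import Mathlib

open MeasureTheory ProbabilityTheory Filter Topology
open scoped ENNReal

namespace SpectralUniversality

/-- Distribution functions of probability measures on the real line. -/
structure IsDistributionFunction (F : ℝ → ℝ) : Prop where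
  mono : Monotone F
  right_continuous : ∀ x, ContinuousWithinAt F (Set.Ici x) x
  tendsto_atBot : Tendsto F atBot (𝓝 0)
  tendsto_atTop : Tendsto F atTop (𝓝 1)

/-- The Lévy distance between two distribution functions. -/
noncomputable def levyDist (F G : ℝ → ℝ) : ℝ :=
  sInf {ε : ℝ | 0 < ε ∧ ∀ x : ℝ, F (x - ε) - ε ≤ G x ∧ G x ≤ F (x + ε) + ε}

/-- `Fₙ ⇒ F` in probability, for random distribution functions `Fₙ` and a nonrandom `F`. -/
def WeakTendstoInProbability {Ω : Type*} [MeasurableSpace Ω] (μ : Measure Ω)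
    (Fn : ℕ → Ω → ℝ → ℝ) (F : ℝ → ℝ) : Prop :=
  ∀ ε : ℝ, 0 < ε → Tendsto (fun n : ℕ => μ {ω | ε < levyDist (Fn n ω) F}) atTop (𝓝 0)

/-- The `n × n` symmetric matrix whose `(i, j)` entry is `x i j` for `i ≥ j` and `x j i` for
`i < j`. The entries are numbered `1, …, n`, so that `k : Fin n` stands for the number `k + 1`. -/
def symMatrix (n : ℕ) (x : ℕ+ → ℕ+ → ℝ) : Matrix (Fin n) (Fin n) ℝ :=
  Matrix.of fun i j =>
    if j ≤ i then x (i : ℕ).succPNat (j : ℕ).succPNat else x (j : ℕ).succPNat (i : ℕ).succPNat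

/-- The normalized symmetric matrix `n ^ (-1/2) • symMatrix n x`. -/
noncomputable def normMatrix (n : ℕ) (x : ℕ+ → ℕ+ → ℝ) : Matrix (Fin n) (Fin n) ℝ :=
  (1 / Real.sqrt n) • symMatrix n x

theorem normMatrix_isHermitian (n : ℕ) (x : ℕ+ → ℕ+ → ℝ) : (normMatrix n x).IsHermitian := by
  ext i j
  rcases lt_trichotomy i j with h | h | h
  · simp [normMatrix, symMatrix, h.le, not_le.mpr h]
  · simp [h]
  · simp [normMatrix, symMatrix, h.le, not_le.mpr h]

/-- The empirical spectral distribution function of `normMatrix n x`: the proportion of its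
eigenvalues (with multiplicity) that are at most `t`. -/
noncomputable def esd (n : ℕ) (x : ℕ+ → ℕ+ → ℝ) (t : ℝ) : ℝ :=
  (1 / (n : ℝ)) *
    ∑ k : Fin n, Set.indicator {s : ℝ | s ≤ t} (fun _ => 1)
      ((normMatrix_isHermitian n x).eigenvalues k)

/-- The set of all `(i, j)` with `1 ≤ j ≤ i ≤ n`. -/
noncomputable def lowerTriangle (n : ℕ) : Finset (ℤ × ℤ) :=
  (Finset.Icc (1 : ℤ) n ×ˢ Finset.Icc (1 : ℤ) n).filter fun p => p.2 ≤ p.1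

/-- The lexicographic order on `ℤ × ℤ`. -/
def LexLE (q p : ℤ × ℤ) : Prop := q.1 < p.1 ∨ (q.1 = p.1 ∧ q.2 ≤ p.2)

/-- The indices that precede `p` lexicographically at sup-distance at least `a` from `p`. -/
def indexPast (a : ℕ) (p : ℤ × ℤ) : Set (ℤ × ℤ) :=
  {q | (a : ℤ) ≤ max |q.1 - p.1| |q.2 - p.2| ∧ LexLE q p}

/-- The sigma-algebra generated by the `X q` with `q` in `indexPast a p` and in the lower
triangle; it is only used at `p` in the lower triangle. -/
@[reducible] def past {Ω : Type*} (X : ℤ × ℤ → Ω → ℝ) (a : ℕ) (p : ℤ × ℤ) : MeasurableSpace Ω :=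
  ⨆ q ∈ {q | q ∈ indexPast a p ∧ q.2 ≤ q.1}, MeasurableSpace.comap (X q) inferInstance

/-- The second moment of the entry at `p`. -/
noncomputable def sigmaSq {Ω : Type*} [MeasurableSpace Ω] (μ : Measure Ω) (X : ℤ × ℤ → Ω → ℝ)
    (p : ℤ × ℤ) : ℝ := ∫ ω, X p ω ^ 2 ∂μ

end SpectralUniversality

/-! The proof compares the two matrices through one smooth test function of the entries, by
Lindeberg replacement. Convolve a distribution function with a Cauchy kernel of scale `η`. For an
empirical spectral distribution, the increment of the result between two points is the integral,
along a segment at height `η`, of the imaginary part of the Stieltjes transform, that is, of the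
normalized trace of a resolvent (`integratedStieltjes_eq`). Finitely many such increments control
the Lévy distance to `F` (`exists_levyDist_le`), and conversely each increment is continuous at `F`
for that distance (`exists_abs_cauchySmooth_sub_lt`). All of them are bounded, so convergence in
probability to the value `κ` for `F` amounts to the expected squared deviation from `κ` tending to
zero. It is therefore enough that these expectations for `X` and for `Y` have the same limit.

The squared deviation has second derivatives of order `n⁻²` and third derivatives of order
`n^(-5/2)`: each derivative in an entry inserts a sparse matrix of size `n^(-1/2)` between
resolvents bounded by `η⁻¹`, and the trace carries a factor `1/n` (`taylorBounds_imStieltjes`,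
`exists_taylorBounds_sq_integratedStieltjes`).

The entries are exchanged one at a time in lexicographic order. When entry `k` is exchanged, its
predecessors are entries of `X` and its successors entries of `Y` (`hybrid_telescope`,
`lindeberg_step`). The first-order terms vanish, by the martingale condition for `X` and by
independence and centering for `Y`. The variances agree, so the second-order term involves only `X k
^ 2 - σ²`. That variable is not orthogonal to the earlier entries, but once the entries within
distance `a` are set to zero, the second derivative depends, for frozen `Y`, only on the past at
distance `a`; what remains is the conditional expectation in the mixing hypothesis. Removing those
boundedly many entries, and the third-order remainders, cost `ε` times a variance plus second
moments truncated at `b = ε√n`. With `n⁻²` in front of the sum over the triangle, the mixing,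
variance and Lindeberg hypotheses finish the estimate (`lindeberg_comparison`,
`tendsto_integral_sub_of_taylorBounds`). -/

namespace SpectralUniversality

/-! ### Taylor bounds in many variables and the operations preserving them. -/

/-- Coordinatewise third-order Taylor control of a function of real variables: `d₁ k` and `d₂ k`
play the role of the first and second partial derivatives in direction `k`. -/
structure TaylorBounds {ι : Type*} [DecidableEq ι] (f : (ι → ℝ) → ℝ)
    (d₁ d₂ : ι → (ι → ℝ) → ℝ) (c₀ c₁ c₂ c₃ : ℝ) : Prop where
  cont : Continuous f
  cont₁ : ∀ k, Continuous (d₁ k)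
  cont₂ : ∀ k, Continuous (d₂ k)
  bound : ∀ x, |f x| ≤ c₀
  bound₁ : ∀ k x, |d₁ k x| ≤ c₁
  bound₂ : ∀ k x, |d₂ k x| ≤ c₂
  lip : ∀ k x t, |f (x + Pi.single k t) - f x| ≤ c₁ * |t|
  lip₁ : ∀ k u x t, |d₁ k (x + Pi.single u t) - d₁ k x| ≤ c₂ * |t|
  lip₂ : ∀ k u x t, |d₂ k (x + Pi.single u t) - d₂ k x| ≤ c₃ * |t|
  taylor₂ : ∀ k x t, |f (x + Pi.single k t) - f x - t * d₁ k x| ≤ c₂ * t ^ 2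
  taylor₃ : ∀ k x t,
    |f (x + Pi.single k t) - f x - t * d₁ k x - t ^ 2 / 2 * d₂ k x| ≤ c₃ * |t| ^ 3

namespace TaylorBounds

variable {ι : Type*} [DecidableEq ι] {f : (ι → ℝ) → ℝ} {d₁ d₂ : ι → (ι → ℝ) → ℝ}
  {c₀ c₁ c₂ c₃ : ℝ}

theorem sub_const (h : TaylorBounds f d₁ d₂ c₀ c₁ c₂ c₃) (κ : ℝ) :
    TaylorBounds (fun x => f x - κ) d₁ d₂ (c₀ + |κ|) c₁ c₂ c₃ where
  cont := h.cont.sub continuous_const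
  cont₁ := h.cont₁
  cont₂ := h.cont₂
  bound x := (abs_sub _ _).trans (add_le_add_left (h.bound x) _)
  bound₁ := h.bound₁
  bound₂ := h.bound₂
  lip k x t := by simpa using h.lip k x t
  lip₁ := h.lip₁
  lip₂ := h.lip₂
  taylor₂ k x t := by simpa using h.taylor₂ k x t
  taylor₃ k x t := by simpa using h.taylor₃ k x t

theorem mul_abs_le {a b p q : ℝ} (ha : |a| ≤ p) (hb : |b| ≤ q) : |a * b| ≤ p * q := by
  rw [abs_mul]
  exact mul_le_mul ha hb (abs_nonneg _) ((abs_nonneg _).trans ha)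

/-- Leibniz rule in finite differences. With `Δ` the increment of `f`, the third-order remainder of
the square is `2 f` times that of `f` plus `(Δ - t d₁)(Δ + t d₁)`, a product of a quadratic and a
linear factor in `t`. -/
theorem sq (h : TaylorBounds f d₁ d₂ c₀ c₁ c₂ c₃) :
    TaylorBounds (fun x => f x ^ 2) (fun k x => 2 * (f x * d₁ k x))
      (fun k x => 2 * (f x * d₂ k x + d₁ k x ^ 2)) (c₀ ^ 2) (2 * (c₀ * c₁))
      (2 * (c₀ * c₂ + c₁ ^ 2)) (2 * (c₀ * c₃ + 3 * (c₁ * c₂))) where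
  cont := h.cont.pow 2
  cont₁ k := continuous_const.mul (h.cont.mul (h.cont₁ k))
  cont₂ k := continuous_const.mul ((h.cont.mul (h.cont₂ k)).add ((h.cont₁ k).pow 2))
  bound x := by
    have := mul_abs_le (h.bound x) (h.bound x)
    rwa [← pow_two, ← pow_two] at this
  bound₁ k x := by
    rw [abs_mul, abs_two]
    exact mul_le_mul_of_nonneg_left (mul_abs_le (h.bound x) (h.bound₁ k x)) zero_le_two
  bound₂ k x := by
    rw [abs_mul, abs_two]
    refine mul_le_mul_of_nonneg_left ((abs_add_le _ _).trans (add_le_add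
      (mul_abs_le (h.bound x) (h.bound₂ k x)) ?_)) zero_le_two
    have := mul_abs_le (h.bound₁ k x) (h.bound₁ k x)
    rwa [← pow_two, ← pow_two] at this
  lip k x t := by
    have h1 := mul_abs_le ((abs_add_le _ _).trans
      (add_le_add (h.bound (x + Pi.single k t)) (h.bound x))) (h.lip k x t)
    calc _ = |(f (x + Pi.single k t) + f x) * (f (x + Pi.single k t) - f x)| := by ring_nf
      _ ≤ _ := h1
      _ = _ := by ring
  lip₁ k u x t := by
    have h1 := mul_abs_le (h.lip u x t) (h.bound₁ k (x + Pi.single u t))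
    have h2 := mul_abs_le (h.bound x) (h.lip₁ k u x t)
    calc _ = |2 * ((f (x + Pi.single u t) - f x) * d₁ k (x + Pi.single u t)
            + f x * (d₁ k (x + Pi.single u t) - d₁ k x))| := by ring_nf
      _ = 2 * |((f (x + Pi.single u t) - f x) * d₁ k (x + Pi.single u t)
            + f x * (d₁ k (x + Pi.single u t) - d₁ k x))| := by rw [abs_mul, abs_two]
      _ ≤ 2 * (c₁ * |t| * c₁ + c₀ * (c₂ * |t|)) := by
        have := abs_add_le ((f (x + Pi.single u t) - f x) * d₁ k (x + Pi.single u t))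
          (f x * (d₁ k (x + Pi.single u t) - d₁ k x))
        linarith
      _ = _ := by ring
  lip₂ k u x t := by
    have h1 := mul_abs_le (h.lip u x t) (h.bound₂ k (x + Pi.single u t))
    have h2 := mul_abs_le (h.bound x) (h.lip₂ k u x t)
    have h3 := mul_abs_le ((abs_add_le _ _).trans
      (add_le_add (h.bound₁ k (x + Pi.single u t)) (h.bound₁ k x))) (h.lip₁ k u x t)
    set a := (f (x + Pi.single u t) - f x) * d₂ k (x + Pi.single u t) with ha
    set b := f x * (d₂ k (x + Pi.single u t) - d₂ k x) with hb
    set c := (d₁ k (x + Pi.single u t) + d₁ k x) * (d₁ k (x + Pi.single u t) - d₁ k x) with hc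
    calc _ = |2 * (a + b + c)| := by rw [ha, hb, hc]; ring_nf
      _ = 2 * |a + b + c| := by rw [abs_mul, abs_two]
      _ ≤ 2 * (c₁ * |t| * c₂ + c₀ * (c₃ * |t|) + (c₁ + c₁) * (c₂ * |t|)) := by
        have := abs_add_three a b c
        linarith
      _ = _ := by ring
  taylor₂ k x t := by
    have h1 := mul_abs_le (h.bound x) (h.taylor₂ k x t)
    have h2 := mul_abs_le (h.lip k x t) (h.lip k x t)
    set a := f x * (f (x + Pi.single k t) - f x - t * d₁ k x) with ha
    set b := (f (x + Pi.single k t) - f x) * (f (x + Pi.single k t) - f x) with hb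
    calc _ = |2 * a + b| := by rw [ha, hb]; ring_nf
      _ ≤ |2 * a| + |b| := abs_add_le _ _
      _ = 2 * |a| + |b| := by rw [abs_mul, abs_two]
      _ ≤ 2 * (c₀ * (c₂ * t ^ 2)) + 2 * (c₁ * |t| * (c₁ * |t|)) := by
        have := abs_nonneg b
        linarith
      _ = 2 * (c₀ * (c₂ * t ^ 2)) + 2 * (c₁ ^ 2 * |t| ^ 2) := by ring
      _ = _ := by rw [sq_abs]; ring
  taylor₃ k x t := by
    have h1 := mul_abs_le (h.bound x) (h.taylor₃ k x t)
    have h3 := mul_abs_le (h.taylor₂ k x t) ((abs_add_le _ _).trans (add_le_add (h.lip k x t)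
      (mul_abs_le (h.bound₁ k x) (le_refl |t|))))
    set a := f x * (f (x + Pi.single k t) - f x - t * d₁ k x - t ^ 2 / 2 * d₂ k x) with ha
    set b := (f (x + Pi.single k t) - f x - t * d₁ k x) *
      (f (x + Pi.single k t) - f x + d₁ k x * t) with hb
    calc _ = |2 * a + b| := by rw [ha, hb]; ring_nf
      _ ≤ |2 * a| + |b| := abs_add_le _ _
      _ = 2 * |a| + |b| := by rw [abs_mul, abs_two]
      -- A factor 1 in place of 3 would do here; the constant `3 * (c₁ * c₂)` is the one needed in
      -- `lip₂`.
      _ ≤ 2 * (c₀ * (c₃ * |t| ^ 3)) + 3 * (c₂ * t ^ 2 * (c₁ * |t| + c₁ * |t|)) := by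
        have := abs_nonneg b
        linarith
      _ = 2 * (c₀ * (c₃ * |t| ^ 3)) + 3 * (c₂ * |t| ^ 2 * (c₁ * |t| + c₁ * |t|)) := by rw [sq_abs]
      _ = _ := by ring

/-- Each bound concerns an expression linear in `f`, `d₁`, `d₂`, so it passes under the integral at
the cost of the length of the interval. -/
theorem intervalIntegral {f : ℝ → (ι → ℝ) → ℝ} {d₁ d₂ : ℝ → ι → (ι → ℝ) → ℝ}
    (h : ∀ e, TaylorBounds (f e) (d₁ e) (d₂ e) c₀ c₁ c₂ c₃)
    (hf : Continuous fun p : (ι → ℝ) × ℝ => f p.2 p.1)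
    (h₁ : ∀ k, Continuous fun p : (ι → ℝ) × ℝ => d₁ p.2 k p.1)
    (h₂ : ∀ k, Continuous fun p : (ι → ℝ) × ℝ => d₂ p.2 k p.1) (a b : ℝ) :
    TaylorBounds (fun x => ∫ e in a..b, f e x) (fun k x => ∫ e in a..b, d₁ e k x)
      (fun k x => ∫ e in a..b, d₂ e k x)
      (c₀ * |b - a|) (c₁ * |b - a|) (c₂ * |b - a|) (c₃ * |b - a|) := by
  have i0 : ∀ x, IntervalIntegrable (fun e => f e x) volume a b := fun x =>
    (hf.comp (Continuous.prodMk_right x)).intervalIntegrable _ _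
  have i1 : ∀ k x, IntervalIntegrable (fun e => d₁ e k x) volume a b := fun k x =>
    ((h₁ k).comp (Continuous.prodMk_right x)).intervalIntegrable _ _
  have i2 : ∀ k x, IntervalIntegrable (fun e => d₂ e k x) volume a b := fun k x =>
    ((h₂ k).comp (Continuous.prodMk_right x)).intervalIntegrable _ _
  have key : ∀ (g : ℝ → ℝ) (C : ℝ), (∀ e, |g e| ≤ C) → |∫ e in a..b, g e| ≤ C * |b - a| :=
    fun g C hg => (Real.norm_eq_abs _).symm.trans_le
      (intervalIntegral.norm_integral_le_of_norm_le_const fun e _ => hg e)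
  refine ⟨?_, ?_, ?_, ?_, ?_, ?_, ?_, ?_, ?_, ?_, ?_⟩
  · exact intervalIntegral.continuous_parametric_intervalIntegral_of_continuous' hf a b
  · exact fun k =>
      intervalIntegral.continuous_parametric_intervalIntegral_of_continuous' (h₁ k) a b
  · exact fun k =>
      intervalIntegral.continuous_parametric_intervalIntegral_of_continuous' (h₂ k) a b
  · exact fun x => key _ _ fun e => (h e).bound x
  · exact fun k x => key _ _ fun e => (h e).bound₁ k x
  · exact fun k x => key _ _ fun e => (h e).bound₂ k x
  · intro k x t
    rw [← intervalIntegral.integral_sub (i0 _) (i0 _), mul_right_comm]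
    exact key _ _ fun e => (h e).lip k x t
  · intro k u x t
    rw [← intervalIntegral.integral_sub (i1 _ _) (i1 _ _), mul_right_comm]
    exact key _ _ fun e => (h e).lip₁ k u x t
  · intro k u x t
    rw [← intervalIntegral.integral_sub (i2 _ _) (i2 _ _), mul_right_comm]
    exact key _ _ fun e => (h e).lip₂ k u x t
  · intro k x t
    rw [← intervalIntegral.integral_sub (i0 _) (i0 _), ← intervalIntegral.integral_const_mul,
      ← intervalIntegral.integral_sub ((i0 _).sub (i0 _)) ((i1 _ _).const_mul _), mul_right_comm]
    exact key _ _ fun e => (h e).taylor₂ k x t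
  · intro k x t
    rw [← intervalIntegral.integral_sub (i0 _) (i0 _), ← intervalIntegral.integral_const_mul,
      ← intervalIntegral.integral_const_mul,
      ← intervalIntegral.integral_sub ((i0 _).sub (i0 _)) ((i1 _ _).const_mul _),
      ← intervalIntegral.integral_sub (((i0 _).sub (i0 _)).sub ((i1 _ _).const_mul _))
        ((i2 _ _).const_mul _), mul_right_comm]
    exact key _ _ fun e => (h e).taylor₃ k x t

end TaylorBounds

end SpectralUniversality

namespace SpectralUniversality

/-! ### Resolvents of real symmetric matrices. -/

section Resolvent

open scoped Matrix.Norms.L2Operator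

variable {n : ℕ}

/-- The resolvent of a real matrix at a complex point. -/
noncomputable def matResolvent (A : Matrix (Fin n) (Fin n) ℝ) (z : ℂ) :
    Matrix (Fin n) (Fin n) ℂ :=
  (A.map Complex.ofReal - z • 1)⁻¹

theorem norm_entry_le_l2_opNorm (M : Matrix (Fin n) (Fin n) ℂ) (i j : Fin n) :
    ‖M i j‖ ≤ ‖M‖ := by
  have h1 := Matrix.l2_opNorm_mulVec M (EuclideanSpace.single j (1 : ℂ))
  have h2 := PiLp.norm_apply_le (p := 2)
    (WithLp.toLp 2 (M.mulVec (EuclideanSpace.single j (1 : ℂ)).ofLp)) i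
  simp at h1 h2
  exact h2.trans h1

theorem l2_opNorm_single_one_le (i j : Fin n) :
    ‖(Matrix.single i j 1 : Matrix (Fin n) (Fin n) ℂ)‖ ≤ 1 := by
  have h := Matrix.l2_opNorm_conjTranspose_mul_self (Matrix.single i j 1 : Matrix (Fin n) (Fin n) ℂ)
  rw [Matrix.conjTranspose_single, Matrix.single_mul_single_same, ← Matrix.diagonal_single,
    Matrix.l2_opNorm_diagonal] at h
  have h2 : ‖(Pi.single j (star 1 * 1) : Fin n → ℂ)‖ ≤ 1 := by
    rw [pi_norm_le_iff_of_nonneg zero_le_one]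
    intro k
    by_cases hk : k = j
    · subst hk; simp
    · simp [hk]
  nlinarith [norm_nonneg (Matrix.single i j 1 : Matrix (Fin n) (Fin n) ℂ)]

theorem l2_opNorm_le_sum (M : Matrix (Fin n) (Fin n) ℂ) : ‖M‖ ≤ ∑ i, ∑ j, ‖M i j‖ := by
  conv_lhs => rw [Matrix.matrix_eq_sum_single M]
  refine (norm_sum_le _ _).trans (Finset.sum_le_sum fun i _ => (norm_sum_le _ _).trans
    (Finset.sum_le_sum fun j _ => ?_))
  have : Matrix.single i j (M i j) = M i j • Matrix.single i j (1 : ℂ) := by simp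
  rw [this, norm_smul]
  exact mul_le_of_le_one_right (norm_nonneg _) (l2_opNorm_single_one_le i j)

/-- Pairing with a sparse `B` costs only the sum of its entries, with no factor `n` from the trace.
This is the source of the decay of the derivatives. -/
theorem norm_trace_mul_le (B M : Matrix (Fin n) (Fin n) ℂ) :
    ‖(B * M).trace‖ ≤ (∑ i, ∑ j, ‖B i j‖) * ‖M‖ := by
  simp only [Matrix.trace, Matrix.diag, Matrix.mul_apply, Finset.sum_mul]
  refine (norm_sum_le _ _).trans (Finset.sum_le_sum fun i _ => (norm_sum_le _ _).trans
    (Finset.sum_le_sum fun j _ => ?_))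
  rw [norm_mul]
  exact mul_le_mul_of_nonneg_left (norm_entry_le_l2_opNorm M j i) (norm_nonneg _)

theorem sub_ne_zero_of_im_ne_zero {z : ℂ} (hz : z.im ≠ 0) (r : ℝ) : (r : ℂ) - z ≠ 0 := by
  intro h
  apply hz
  have := congrArg Complex.im h
  simpa using this

/-- The complexified eigenvector matrix stays unitary, and a real eigenvalue never equals a nonreal
`z`. Invertibility, the norm bound and the trace formula all follow from this factorization. -/
theorem exists_diagonalization {A : Matrix (Fin n) (Fin n) ℝ} (hA : A.IsHermitian) {z : ℂ}
    (hz : z.im ≠ 0) :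
    ∃ U ∈ unitary (Matrix (Fin n) (Fin n) ℂ),
      IsUnit (A.map Complex.ofReal - z • 1) ∧
      matResolvent A z =
        U * Matrix.diagonal (fun i => ((hA.eigenvalues i : ℂ) - z)⁻¹) * star U := by
  set V := (hA.eigenvectorUnitary : Matrix (Fin n) (Fin n) ℝ)
  set U : Matrix (Fin n) (Fin n) ℂ := V.map Complex.ofReal with hU
  have hstar : star U = (star V).map Complex.ofReal := by
    ext i j; simp [hU, Matrix.star_apply]
  have h1 : star U * U = 1 := by
    have : star V * V = 1 := Unitary.coe_star_mul_self _
    rw [hstar, hU]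
    have := congrArg (fun M : Matrix (Fin n) (Fin n) ℝ => M.map Complex.ofRealHom) this
    simp only [Matrix.map_mul] at this
    refine this.trans ?_
    ext i j
    by_cases h : i = j
    · subst h; simp
    · simp [h]
  have h2 : U * star U = 1 := mul_eq_one_comm.mp h1
  have hspec : A.map Complex.ofReal =
      U * Matrix.diagonal (fun i => (hA.eigenvalues i : ℂ)) * star U := by
    have := congrArg (fun M : Matrix (Fin n) (Fin n) ℝ => M.map Complex.ofRealHom)
      hA.spectral_theorem
    simp only [Unitary.conjStarAlgAut_apply, Matrix.map_mul] at this
    rw [hstar]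
    refine this.trans ?_
    congr 2
    ext i j
    by_cases h : i = j
    · subst h; simp
    · simp [h]
  have hsub : A.map Complex.ofReal - z • 1 =
      U * Matrix.diagonal (fun i => (hA.eigenvalues i : ℂ) - z) * star U := by
    have : Matrix.diagonal (fun i => (hA.eigenvalues i : ℂ) - z) =
        Matrix.diagonal (fun i => (hA.eigenvalues i : ℂ)) - z • 1 := by
      ext i j
      by_cases h : i = j
      · subst h; simp
      · simp [h]
    rw [this, mul_sub, sub_mul, ← hspec]
    simp [h2]
  have hmul : (A.map Complex.ofReal - z • 1) *
      (U * Matrix.diagonal (fun i => ((hA.eigenvalues i : ℂ) - z)⁻¹) * star U) = 1 := by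
    rw [hsub]
    calc _ = U * Matrix.diagonal (fun i => (hA.eigenvalues i : ℂ) - z) * (star U * U) *
        Matrix.diagonal (fun i => ((hA.eigenvalues i : ℂ) - z)⁻¹) * star U := by
          simp only [mul_assoc]
      _ = U * (Matrix.diagonal (fun i => (hA.eigenvalues i : ℂ) - z) *
        Matrix.diagonal (fun i => ((hA.eigenvalues i : ℂ) - z)⁻¹)) * star U := by
          rw [h1, mul_one]; simp only [mul_assoc]
      _ = 1 := by
        rw [Matrix.diagonal_mul_diagonal]
        simp [mul_inv_cancel₀ (sub_ne_zero_of_im_ne_zero hz _), h2]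
  refine ⟨U, ⟨h1, h2⟩, IsUnit.of_mul_eq_one _ hmul, ?_⟩
  exact Matrix.inv_eq_right_inv hmul

theorem norm_matResolvent_le {A : Matrix (Fin n) (Fin n) ℝ} (hA : A.IsHermitian) {z : ℂ}
    (hz : z.im ≠ 0) : ‖matResolvent A z‖ ≤ |z.im|⁻¹ := by
  obtain ⟨U, hU, -, h⟩ := exists_diagonalization hA hz
  have hU1 : ‖U‖ ≤ 1 := by
    -- For `n = 0` the matrix ring is trivial and a unitary has norm 0 instead of 1.
    rcases subsingleton_or_nontrivial (Matrix (Fin n) (Fin n) ℂ) with _ | _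
    · rw [Subsingleton.elim U 0, norm_zero]; exact zero_le_one
    · exact (CStarRing.norm_of_mem_unitary hU).le
  have hz' : 0 < |z.im| := abs_pos.mpr hz
  have hD : ‖Matrix.diagonal (fun i => ((hA.eigenvalues i : ℂ) - z)⁻¹)‖ ≤ |z.im|⁻¹ := by
    rw [Matrix.l2_opNorm_diagonal, pi_norm_le_iff_of_nonneg (inv_nonneg.mpr hz'.le)]
    intro i
    rw [norm_inv]
    refine inv_anti₀ hz' ?_
    have := Complex.abs_im_le_norm ((hA.eigenvalues i : ℂ) - z)
    simpa using this
  rw [h]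
  calc _ ≤ ‖U‖ * ‖Matrix.diagonal (fun i => ((hA.eigenvalues i : ℂ) - z)⁻¹)‖ * ‖star U‖ :=
        (norm_mul_le _ _).trans (mul_le_mul_of_nonneg_right (norm_mul_le _ _) (norm_nonneg _))
    _ ≤ 1 * |z.im|⁻¹ * 1 := by
        rw [norm_star]
        gcongr
    _ = _ := by ring

theorem trace_matResolvent {A : Matrix (Fin n) (Fin n) ℝ} (hA : A.IsHermitian) {z : ℂ}
    (hz : z.im ≠ 0) :
    (matResolvent A z).trace = ∑ i, ((hA.eigenvalues i : ℂ) - z)⁻¹ := by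
  obtain ⟨U, hU, -, h⟩ := exists_diagonalization hA hz
  rw [h, Matrix.trace_mul_comm, ← mul_assoc, hU.1, one_mul, Matrix.trace_diagonal]

theorem matResolvent_add_smul {A B : Matrix (Fin n) (Fin n) ℝ} (hA : A.IsHermitian)
    (hB : B.IsHermitian) {z : ℂ} (hz : z.im ≠ 0) (t : ℝ) :
    matResolvent (A + t • B) z =
      matResolvent A z -
        (t : ℂ) • (matResolvent (A + t • B) z * B.map Complex.ofReal * matResolvent A z) := by
  obtain ⟨-, -, h1, -⟩ := exists_diagonalization hA hz
  obtain ⟨-, -, h2, -⟩ := exists_diagonalization (hA.add (hB.smul (IsSelfAdjoint.all t))) hz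
  have h := Matrix.inv_sub_inv (A := (A + t • B).map Complex.ofReal - z • 1)
    (B := A.map Complex.ofReal - z • 1) (iff_of_true h2 h1)
  have hd : (A.map Complex.ofReal - z • 1) - ((A + t • B).map Complex.ofReal - z • 1) =
      -((t : ℂ) • B.map Complex.ofReal) := by
    ext i j; simp
  rw [hd] at h
  refine (eq_add_of_sub_eq h).trans ?_
  simp only [matResolvent, mul_neg, neg_mul, Matrix.mul_smul, Matrix.smul_mul]
  abel

theorem continuous_matResolvent {Z : Type*} [TopologicalSpace Z]
    {A : Z → Matrix (Fin n) (Fin n) ℝ} {z : Z → ℂ} (hA : Continuous A) (hz : Continuous z)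
    (hAh : ∀ y, (A y).IsHermitian) (hz0 : ∀ y, (z y).im ≠ 0) :
    Continuous fun y => matResolvent (A y) (z y) := by
  have hc : Continuous fun y => (A y).map Complex.ofReal - z y • (1 : Matrix (Fin n) (Fin n) ℂ) := 
    (hA.matrix_map Complex.continuous_ofReal).sub (hz.smul continuous_const)
  simp only [matResolvent, Matrix.inv_def, Ring.inverse_eq_inv]
  refine (hc.matrix_det.inv₀ fun y => ?_).smul hc.matrix_adjugate
  obtain ⟨-, -, h1, -⟩ := exists_diagonalization (hAh y) (hz0 y)
  exact ((Matrix.isUnit_iff_isUnit_det _).mp h1).ne_zero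

/-- Cyclicity brings the outer factors together, leaving a trace against `B` alone. Further
insertions are then bounded in operator norm by `norm_mul_mul_le`. -/
theorem norm_trace_mul_mul_le {B M₁ M₂ : Matrix (Fin n) (Fin n) ℂ} {γ r₁ r₂ : ℝ}
    (hB : ∑ i, ∑ j, ‖B i j‖ ≤ γ) (h₁ : ‖M₁‖ ≤ r₁) (h₂ : ‖M₂‖ ≤ r₂) :
    ‖(M₁ * B * M₂).trace‖ ≤ γ * (r₂ * r₁) := by
  rw [mul_assoc, Matrix.trace_mul_comm, mul_assoc]
  have hr₂ : 0 ≤ r₂ := (norm_nonneg _).trans h₂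
  refine (norm_trace_mul_le _ _).trans (mul_le_mul hB ((norm_mul_le _ _).trans
    (mul_le_mul h₂ h₁ (norm_nonneg _) hr₂)) (norm_nonneg _) (le_trans ?_ hB))
  positivity

theorem norm_mul_mul_le {B M₁ M₂ : Matrix (Fin n) (Fin n) ℂ} {γ r₁ r₂ : ℝ}
    (hB : ∑ i, ∑ j, ‖B i j‖ ≤ γ) (h₁ : ‖M₁‖ ≤ r₁) (h₂ : ‖M₂‖ ≤ r₂) :
    ‖M₁ * (B * M₂)‖ ≤ r₁ * (γ * r₂) := by
  have hr₁ : 0 ≤ r₁ := (norm_nonneg _).trans h₁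
  have hB' := (l2_opNorm_le_sum B).trans hB
  have hγ : 0 ≤ γ := (norm_nonneg _).trans hB'
  exact (norm_mul_le _ _).trans (mul_le_mul h₁ ((norm_mul_le _ _).trans
    (mul_le_mul hB' h₂ (norm_nonneg _) hγ)) (norm_nonneg _) hr₁)

section Words

variable {R₁ R₂ R₃ R₄ B C D : Matrix (Fin n) (Fin n) ℂ} {γ β : ℝ}

theorem norm_trace_word_one (h₁ : ‖R₁‖ ≤ β) (h₂ : ‖R₂‖ ≤ β) (hB : ∑ i, ∑ j, ‖B i j‖ ≤ γ) :
    ‖(R₁ * B * R₂).trace‖ ≤ γ * β ^ 2 :=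
  (norm_trace_mul_mul_le hB h₁ h₂).trans_eq (by ring)

theorem norm_trace_word_two (h₁ : ‖R₁‖ ≤ β) (h₂ : ‖R₂‖ ≤ β) (h₃ : ‖R₃‖ ≤ β)
    (hB : ∑ i, ∑ j, ‖B i j‖ ≤ γ) (hC : ∑ i, ∑ j, ‖C i j‖ ≤ γ) :
    ‖(R₁ * B * R₂ * C * R₃).trace‖ ≤ γ ^ 2 * β ^ 3 := by
  have := norm_trace_mul_mul_le hB h₁ (norm_mul_mul_le hC h₂ h₃)
  simp only [← mul_assoc] at this
  exact this.trans_eq (by ring)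

theorem norm_trace_word_three (h₁ : ‖R₁‖ ≤ β) (h₂ : ‖R₂‖ ≤ β) (h₃ : ‖R₃‖ ≤ β) (h₄ : ‖R₄‖ ≤ β)
    (hB : ∑ i, ∑ j, ‖B i j‖ ≤ γ) (hC : ∑ i, ∑ j, ‖C i j‖ ≤ γ) (hD : ∑ i, ∑ j, ‖D i j‖ ≤ γ) :
    ‖(R₁ * B * R₂ * C * R₃ * D * R₄).trace‖ ≤ γ ^ 3 * β ^ 4 := by
  have := norm_trace_mul_mul_le hB h₁ (norm_mul_mul_le hC h₂ (norm_mul_mul_le hD h₃ h₄))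
  simp only [← mul_assoc] at this
  exact this.trans_eq (by ring)

end Words

section Perturbation

variable {R S B C : Matrix (Fin n) (Fin n) ℂ} {t : ℂ}

theorem perturb_mul (h : S = R - t • (S * B * R)) (M : Matrix (Fin n) (Fin n) ℂ) :
    S * M = R * M - t • (S * B * R * M) := by
  conv_lhs => rw [h]
  rw [sub_mul, Matrix.smul_mul]

/-- The resolvent identity substituted into itself gives a finite expansion with exact remainder, in
which a single factor is the perturbed resolvent. No differentiation is needed. -/
theorem perturb_two (h : S = R - t • (S * B * R)) :
    S - R + t • (R * B * R) = t ^ 2 • (S * B * R * B * R) := by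
  have h1 := perturb_mul h (B * R)
  simp only [← mul_assoc] at h1
  have h2 : S - R = -(t • (S * B * R)) := by
    rw [sub_eq_iff_eq_add]; conv_lhs => rw [h]
    abel
  rw [h2]
  nth_rewrite 1 [h1]
  module

theorem perturb_three (h : S = R - t • (S * B * R)) :
    S - R + t • (R * B * R) - t ^ 2 • (R * B * R * B * R) =
      -(t ^ 3 • (S * B * R * B * R * B * R)) := by
  have h1 := perturb_mul h (B * R * B * R)
  simp only [← mul_assoc] at h1
  rw [perturb_two h]
  nth_rewrite 1 [h1]
  module

theorem perturb_lip_one (h : S = R - t • (S * C * R)) :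
    S * B * S - R * B * R = -(t • (S * C * R * B * S + R * B * S * C * R)) := by
  have h2 : S - R = -(t • (S * C * R)) := by
    rw [sub_eq_iff_eq_add]; conv_lhs => rw [h]
    abel
  have : S * B * S - R * B * R = (S - R) * B * S + R * B * (S - R) := by noncomm_ring
  rw [this, h2]
  simp only [neg_mul, mul_neg, Matrix.smul_mul, Matrix.mul_smul, smul_add, neg_add, ← mul_assoc]

theorem perturb_lip_two (h : S = R - t • (S * C * R)) :
    S * B * S * B * S - R * B * R * B * R =
      -(t • (S * C * R * B * S * B * S + R * B * S * C * R * B * S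
        + R * B * R * B * S * C * R)) := by
  have h2 : S - R = -(t • (S * C * R)) := by
    rw [sub_eq_iff_eq_add]; conv_lhs => rw [h]
    abel
  have : S * B * S * B * S - R * B * R * B * R =
      (S - R) * B * S * B * S + R * B * (S - R) * B * S + R * B * R * B * (S - R) := by noncomm_ring
  rw [this, h2]
  simp only [neg_mul, mul_neg, Matrix.smul_mul, Matrix.mul_smul, smul_add, neg_add, ← mul_assoc]

end Perturbation

end Resolvent

end SpectralUniversality

namespace SpectralUniversality

/-! ### The Stieltjes transform as a function of the matrix entries. -/

section Stieltjes

open scoped Matrix.Norms.L2Operator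

/-- The matrix `normMatrix` of an array indexed by pairs of integers. -/
noncomputable def arrayMatrix (n : ℕ) (x : ℤ × ℤ → ℝ) : Matrix (Fin n) (Fin n) ℝ :=
  normMatrix n fun i j => x ((i : ℤ), (j : ℤ))

theorem arrayMatrix_isHermitian (n : ℕ) (x : ℤ × ℤ → ℝ) : (arrayMatrix n x).IsHermitian :=
  normMatrix_isHermitian _ _

theorem arrayMatrix_apply (n : ℕ) (x : ℤ × ℤ → ℝ) (i j : Fin n) :
    arrayMatrix n x i j = (1 / Real.sqrt n) *
      if j ≤ i then x ((i : ℤ) + 1, (j : ℤ) + 1) else x ((j : ℤ) + 1, (i : ℤ) + 1) := by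
  simp [arrayMatrix, normMatrix, symMatrix]

theorem arrayMatrix_add_single (n : ℕ) (x : ℤ × ℤ → ℝ) (p : ℤ × ℤ) (t : ℝ) :
    arrayMatrix n (x + Pi.single p t) =
      arrayMatrix n x + t • arrayMatrix n (Pi.single p 1) := by
  ext i j
  simp only [Matrix.add_apply, Matrix.smul_apply, arrayMatrix_apply, smul_eq_mul, Pi.add_apply,
    Pi.single_apply]
  split_ifs <;> ring

theorem continuous_arrayMatrix (n : ℕ) : Continuous (arrayMatrix n) := by
  refine continuous_matrix fun i j => ?_
  simp only [arrayMatrix_apply]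
  split_ifs <;> fun_prop

/-- A coordinate occupies at most two positions of the symmetric matrix, itself and its mirror
image. -/
theorem sum_norm_arrayMatrix_single_le (n : ℕ) (p : ℤ × ℤ) :
    ∑ i, ∑ j, ‖(arrayMatrix n (Pi.single p 1)).map Complex.ofReal i j‖ ≤ 2 / Real.sqrt n := by
  have key : ∀ f : Fin n × Fin n → ℤ × ℤ, Function.Injective f →
      ∑ q : Fin n × Fin n, (if f q = p then (1 : ℝ) else 0) ≤ 1 := by
    intro f hf
    rw [Finset.sum_boole]
    have : (Finset.univ.filter fun q => f q = p).card ≤ 1 := by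
      rw [Finset.card_le_one]
      simp only [Finset.mem_filter, Finset.mem_univ, true_and]
      exact fun a ha b hb => hf (ha.trans hb.symm)
    exact_mod_cast this
  have h1 := key (fun q => ((q.1 : ℤ) + 1, (q.2 : ℤ) + 1)) (by
    rintro ⟨a, b⟩ ⟨c, d⟩ h; simp at h; ext <;> simp <;> omega)
  have h2 := key (fun q => ((q.2 : ℤ) + 1, (q.1 : ℤ) + 1)) (by
    rintro ⟨a, b⟩ ⟨c, d⟩ h; simp at h; ext <;> simp <;> omega)
  rw [← Fintype.sum_prod_type']
  calc _ ≤ ∑ q : Fin n × Fin n, (1 / Real.sqrt n) *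
        ((if ((q.1 : ℤ) + 1, (q.2 : ℤ) + 1) = p then (1 : ℝ) else 0) +
          (if ((q.2 : ℤ) + 1, (q.1 : ℤ) + 1) = p then (1 : ℝ) else 0)) := by
        refine Finset.sum_le_sum fun q _ => ?_
        rw [Matrix.map_apply, Complex.norm_real, arrayMatrix_apply, norm_mul,
          Real.norm_of_nonneg (by positivity)]
        refine mul_le_mul_of_nonneg_left ?_ (by positivity)
        simp only [Pi.single_apply]
        split_ifs <;> simp
    _ ≤ (1 / Real.sqrt n) * (1 + 1) := by
        rw [← Finset.mul_sum, Finset.sum_add_distrib]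
        exact mul_le_mul_of_nonneg_left (add_le_add h1 h2) (by positivity)
    _ = _ := by ring

/-- The imaginary part of the Stieltjes transform of the empirical spectral distribution. -/
noncomputable def imStieltjes (n : ℕ) (z : ℂ) (x : ℤ × ℤ → ℝ) : ℝ :=
  (1 / (n : ℝ)) * (matResolvent (arrayMatrix n x) z).trace.im

/-- The partial derivatives of `imStieltjes`. -/
noncomputable def imStieltjesD₁ (n : ℕ) (z : ℂ) (p : ℤ × ℤ) (x : ℤ × ℤ → ℝ) : ℝ :=
  -((1 / (n : ℝ)) * (matResolvent (arrayMatrix n x) z *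
    (arrayMatrix n (Pi.single p 1)).map Complex.ofReal * matResolvent (arrayMatrix n x) z).trace.im)

/-- The pure second partial derivatives of `imStieltjes`. -/
noncomputable def imStieltjesD₂ (n : ℕ) (z : ℂ) (p : ℤ × ℤ) (x : ℤ × ℤ → ℝ) : ℝ :=
  2 * ((1 / (n : ℝ)) * (matResolvent (arrayMatrix n x) z *
    (arrayMatrix n (Pi.single p 1)).map Complex.ofReal * matResolvent (arrayMatrix n x) z *
    (arrayMatrix n (Pi.single p 1)).map Complex.ofReal * matResolvent (arrayMatrix n x) z).trace.im)

section Continuity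

variable {Z : Type*} [TopologicalSpace Z] {x : Z → ℤ × ℤ → ℝ} {z : Z → ℂ}

theorem continuous_matResolvent_arrayMatrix (n : ℕ) (hx : Continuous x) (hz : Continuous z)
    (hz0 : ∀ y, (z y).im ≠ 0) : Continuous fun y => matResolvent (arrayMatrix n (x y)) (z y) :=
  continuous_matResolvent ((continuous_arrayMatrix n).comp hx) hz
    (fun _ => arrayMatrix_isHermitian _ _) hz0

theorem continuous_imStieltjes (n : ℕ) (hx : Continuous x) (hz : Continuous z)
    (hz0 : ∀ y, (z y).im ≠ 0) : Continuous fun y => imStieltjes n (z y) (x y) := by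
  have h := continuous_matResolvent_arrayMatrix n hx hz hz0
  exact continuous_const.mul (Complex.continuous_im.comp h.matrix_trace)

theorem continuous_imStieltjesD₁ (n : ℕ) (p : ℤ × ℤ) (hx : Continuous x) (hz : Continuous z)
    (hz0 : ∀ y, (z y).im ≠ 0) : Continuous fun y => imStieltjesD₁ n (z y) p (x y) := by
  have h := continuous_matResolvent_arrayMatrix n hx hz hz0
  exact (continuous_const.mul (Complex.continuous_im.comp
    ((h.mul continuous_const).mul h).matrix_trace)).neg

theorem continuous_imStieltjesD₂ (n : ℕ) (p : ℤ × ℤ) (hx : Continuous x) (hz : Continuous z)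
    (hz0 : ∀ y, (z y).im ≠ 0) : Continuous fun y => imStieltjesD₂ n (z y) p (x y) := by
  have h := continuous_matResolvent_arrayMatrix n hx hz hz0
  exact continuous_const.mul (continuous_const.mul (Complex.continuous_im.comp
    ((((h.mul continuous_const).mul h).mul continuous_const).mul h).matrix_trace))

end Continuity

theorem abs_im_mul_le {a : ℂ} {w c C : ℝ} (hw : 0 ≤ w) (ha : ‖a‖ ≤ c) (h : w * c ≤ C) :
    |w * a.im| ≤ C := by
  rw [abs_mul, abs_of_nonneg hw]
  exact (mul_le_mul_of_nonneg_left ((Complex.abs_im_le_norm a).trans ha) hw).trans h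

/-- Derivatives, their increments and the Taylor remainders are all combinations of traces of words
in which `m` copies of `B` alternate with `m + 1` resolvents, each word being at most `γ ^ m * β ^
(m + 1)`. The factors 2 and 6 count the words produced when `d₁` and `d₂` are perturbed. -/
theorem taylorBounds_imStieltjes (n : ℕ) {z : ℂ} (hz : z.im ≠ 0) {β γ : ℝ}
    (hβ : β = |z.im|⁻¹) (hγ : γ = 2 / Real.sqrt n) :
    TaylorBounds (imStieltjes n z) (imStieltjesD₁ n z) (imStieltjesD₂ n z)
      β (1 / (n : ℝ) * (γ * β ^ 2)) (2 * (1 / (n : ℝ) * (γ ^ 2 * β ^ 3)))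
      (6 * (1 / (n : ℝ) * (γ ^ 3 * β ^ 4))) := by
  have hβ0 : 0 ≤ β := by rw [hβ]; positivity
  have hγ0 : 0 ≤ γ := by rw [hγ]; positivity
  set w : ℝ := 1 / (n : ℝ) with hw
  have hw0 : 0 ≤ w := by positivity
  have hR : ∀ x, ‖matResolvent (arrayMatrix n x) z‖ ≤ β := fun x =>
    hβ ▸ norm_matResolvent_le (arrayMatrix_isHermitian n x) hz
  set B : ℤ × ℤ → Matrix (Fin n) (Fin n) ℂ :=
    fun p => (arrayMatrix n (Pi.single p 1)).map Complex.ofReal with hBdef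
  have hB : ∀ p, ∑ i, ∑ j, ‖B p i j‖ ≤ γ := fun p =>
    hγ ▸ sum_norm_arrayMatrix_single_le n p
  have hpert : ∀ x p t, matResolvent (arrayMatrix n (x + Pi.single p t)) z =
      matResolvent (arrayMatrix n x) z - (t : ℂ) •
        (matResolvent (arrayMatrix n (x + Pi.single p t)) z * B p *
          matResolvent (arrayMatrix n x) z) := by
    intro x p t
    rw [arrayMatrix_add_single]
    exact matResolvent_add_smul (arrayMatrix_isHermitian n x) (arrayMatrix_isHermitian n _) hz t
  have hs1 : ∀ (a : ℝ) (c : ℂ), (((a : ℝ) : ℂ) * c).im = a * c.im := fun a c => by simp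
  refine ⟨continuous_imStieltjes n continuous_id continuous_const fun _ => hz,
    fun p => continuous_imStieltjesD₁ n p continuous_id continuous_const fun _ => hz,
    fun p => continuous_imStieltjesD₂ n p continuous_id continuous_const fun _ => hz,
    ?_, ?_, ?_, ?_, ?_, ?_, ?_, ?_⟩
  · intro x
    have h1 : ‖(matResolvent (arrayMatrix n x) z).trace‖ ≤ n * β := by
      refine (norm_sum_le _ _).trans ((Finset.sum_le_card_nsmul _ _ β fun i _ =>
        (norm_entry_le_l2_opNorm _ i i).trans (hR x)).trans_eq ?_)
      simp
    refine abs_im_mul_le hw0 h1 ?_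
    rw [← mul_assoc]
    refine mul_le_of_le_one_left hβ0 ?_
    rw [one_div]
    exact inv_mul_le_one
  · intro k x
    rw [imStieltjesD₁, abs_neg]
    exact abs_im_mul_le hw0 (norm_trace_word_one (hR x) (hR x) (hB k)) le_rfl
  · intro k x
    rw [imStieltjesD₂, abs_mul, abs_two]
    exact mul_le_mul_of_nonneg_left (abs_im_mul_le hw0
      (norm_trace_word_two (hR x) (hR x) (hR x) (hB k) (hB k)) le_rfl) zero_le_two
  · intro k x t
    have h := hpert x k t
    set R := matResolvent (arrayMatrix n x) z with hRd
    set S := matResolvent (arrayMatrix n (x + Pi.single k t)) z with hSd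
    have hSR : S - R = -((t : ℂ) • (S * B k * R)) := by
      rw [sub_eq_iff_eq_add]; conv_lhs => rw [h]
      abel
    have e : imStieltjes n z (x + Pi.single k t) - imStieltjes n z x =
        -t * (w * (S * B k * R).trace.im) := by
      have := congrArg (fun M => w * M.trace.im) hSR
      simp only [Matrix.trace_sub, Matrix.trace_neg, Matrix.trace_smul, Complex.sub_im,
        Complex.neg_im, smul_eq_mul, hs1] at this
      simp only [imStieltjes, ← hRd, ← hSd]
      linear_combination this
    rw [e, abs_mul, abs_neg, mul_comm]
    exact mul_le_mul_of_nonneg_right (abs_im_mul_le hw0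
      (norm_trace_word_one (hR _) (hR x) (hB k)) le_rfl) (abs_nonneg t)
  · intro k u x t
    have h := perturb_lip_one (B := B k) (hpert x u t)
    set R := matResolvent (arrayMatrix n x) z with hRd
    set S := matResolvent (arrayMatrix n (x + Pi.single u t)) z with hSd
    have e : imStieltjesD₁ n z k (x + Pi.single u t) - imStieltjesD₁ n z k x =
        t * (w * (S * B u * R * B k * S).trace.im + w * (R * B k * S * B u * R).trace.im) := by
      have := congrArg (fun M => w * M.trace.im) h
      simp only [Matrix.trace_sub, Matrix.trace_neg, Matrix.trace_add, Matrix.trace_smul,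
        Complex.sub_im, Complex.neg_im, Complex.add_im, smul_eq_mul, hs1] at this
      simp only [imStieltjesD₁, ← hRd, ← hSd]
      linear_combination -this
    rw [e, abs_mul, mul_comm]
    refine mul_le_mul_of_nonneg_right ?_ (abs_nonneg t)
    refine (abs_add_le _ _).trans ((add_le_add (abs_im_mul_le hw0
      (norm_trace_word_two (hR _) (hR _) (hR _) (hB _) (hB _)) le_rfl)
      (abs_im_mul_le hw0 (norm_trace_word_two (hR _) (hR _) (hR _) (hB _) (hB _)) le_rfl)).trans_eq
      (by ring))
  · intro k u x t
    have h := perturb_lip_two (B := B k) (hpert x u t)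
    set R := matResolvent (arrayMatrix n x) z with hRd
    set S := matResolvent (arrayMatrix n (x + Pi.single u t)) z with hSd
    have e : imStieltjesD₂ n z k (x + Pi.single u t) - imStieltjesD₂ n z k x =
        -(2 * t) * (w * (S * B u * R * B k * S * B k * S).trace.im
          + w * (R * B k * S * B u * R * B k * S).trace.im
          + w * (R * B k * R * B k * S * B u * R).trace.im) := by
      have := congrArg (fun M => w * M.trace.im) h
      simp only [Matrix.trace_sub, Matrix.trace_neg, Matrix.trace_add, Matrix.trace_smul,
        Complex.sub_im, Complex.neg_im, Complex.add_im, smul_eq_mul, hs1] at this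
      simp only [imStieltjesD₂, ← hRd, ← hSd]
      linear_combination 2 * this
    have h3 : ∀ {R₁ R₂ R₃ R₄ M₁ M₂ M₃ : Matrix (Fin n) (Fin n) ℂ}, ‖R₁‖ ≤ β → ‖R₂‖ ≤ β →
        ‖R₃‖ ≤ β → ‖R₄‖ ≤ β → ∑ i, ∑ j, ‖M₁ i j‖ ≤ γ → ∑ i, ∑ j, ‖M₂ i j‖ ≤ γ →
        ∑ i, ∑ j, ‖M₃ i j‖ ≤ γ →
        |w * (R₁ * M₁ * R₂ * M₂ * R₃ * M₃ * R₄).trace.im| ≤ w * (γ ^ 3 * β ^ 4) :=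
      fun h1 h2 h3 h4 h5 h6 h7 =>
        abs_im_mul_le hw0 (norm_trace_word_three h1 h2 h3 h4 h5 h6 h7) le_rfl
    rw [e, abs_mul, abs_neg, abs_mul, abs_two]
    have hRx : ‖R‖ ≤ β := hR x
    have hSx : ‖S‖ ≤ β := hR _
    have := (abs_add_three _ _ _).trans (add_le_add (add_le_add
      (h3 hSx hRx hSx hSx (hB u) (hB k) (hB k)) (h3 hRx hSx hRx hSx (hB k) (hB u) (hB k)))
      (h3 hRx hRx hSx hRx (hB k) (hB k) (hB u)))
    exact (mul_le_mul_of_nonneg_left this (by positivity)).trans_eq (by ring)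
  · intro k x t
    have h := perturb_two (hpert x k t)
    set R := matResolvent (arrayMatrix n x) z with hRd
    set S := matResolvent (arrayMatrix n (x + Pi.single k t)) z with hSd
    have e : imStieltjes n z (x + Pi.single k t) - imStieltjes n z x - t * imStieltjesD₁ n z k x =
        t ^ 2 * (w * (S * B k * R * B k * R).trace.im) := by
      have := congrArg (fun M => w * M.trace.im) h
      simp only [Matrix.trace_sub, Matrix.trace_add, Matrix.trace_smul, Complex.sub_im,
        Complex.add_im, smul_eq_mul, ← Complex.ofReal_pow, hs1] at this
      simp only [imStieltjes, imStieltjesD₁, ← hRd, ← hSd]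
      linear_combination this
    rw [e, abs_mul, abs_of_nonneg (sq_nonneg t), mul_comm]
    refine mul_le_mul_of_nonneg_right (abs_im_mul_le hw0
      (norm_trace_word_two (hR _) (hR x) (hR x) (hB k) (hB k)) ?_) (sq_nonneg t)
    have : 0 ≤ w * (γ ^ 2 * β ^ 3) := by positivity
    linarith
  · intro k x t
    have h := perturb_three (hpert x k t)
    set R := matResolvent (arrayMatrix n x) z with hRd
    set S := matResolvent (arrayMatrix n (x + Pi.single k t)) z with hSd
    have e : imStieltjes n z (x + Pi.single k t) - imStieltjes n z x - t * imStieltjesD₁ n z k x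
        - t ^ 2 / 2 * imStieltjesD₂ n z k x =
        -(t ^ 3) * (w * (S * B k * R * B k * R * B k * R).trace.im) := by
      have := congrArg (fun M => w * M.trace.im) h
      simp only [Matrix.trace_sub, Matrix.trace_add, Matrix.trace_smul, Complex.sub_im,
        Matrix.trace_neg, Complex.neg_im,
        Complex.add_im, smul_eq_mul, ← Complex.ofReal_pow, hs1] at this
      simp only [imStieltjes, imStieltjesD₁, imStieltjesD₂, ← hRd, ← hSd]
      linear_combination this
    rw [e, abs_mul, abs_neg, abs_pow, mul_comm]
    refine mul_le_mul_of_nonneg_right (abs_im_mul_le hw0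
      (norm_trace_word_three (hR _) (hR x) (hR x) (hR x) (hB k) (hB k) (hB k)) ?_) (by positivity)
    have : 0 ≤ w * (γ ^ 3 * β ^ 4) := by positivity
    linarith

theorem imStieltjes_eq_sum (n : ℕ) (x : ℤ × ℤ → ℝ) (e : ℝ) {η : ℝ} (hη : 0 < η) :
    imStieltjes n ⟨e, η⟩ x = (1 / (n : ℝ)) * ∑ k : Fin n,
      η / (((arrayMatrix_isHermitian n x).eigenvalues k - e) ^ 2 + η ^ 2) := by
  rw [imStieltjes, trace_matResolvent (arrayMatrix_isHermitian n x) (by simpa using hη.ne'),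
    Complex.im_sum]
  congr 1
  refine Finset.sum_congr rfl fun k _ => ?_
  rw [Complex.inv_im, Complex.normSq_apply]
  simp [pow_two]

end Stieltjes

end SpectralUniversality

namespace SpectralUniversality

/-! ### Hybrid vectors and telescoping. -/

section Hybrid

variable {ι : Type*} [DecidableEq ι]

/-- The vector that agrees with `x` on `U`, with `y` on `V \ U`, and with `w` elsewhere. -/
def hybrid (U V : Finset ι) (x y w : ι → ℝ) : ι → ℝ :=
  fun p => if p ∈ U then x p else if p ∈ V then y p else w p

/-- Induction on the last index `a`. Its summand exchanges the coordinate `a` when all the others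
come from `x`; in the remaining sum that coordinate is frozen at `y a`. The freezing is stored in
the base vector `w`, which is therefore generalized. -/
theorem hybrid_telescope {α : Type*} [LinearOrder α] {r : ι → α} (hr : Function.Injective r)
    (g : (ι → ℝ) → ℝ) (s : Finset ι) (x y w : ι → ℝ) :
    g (hybrid s ∅ x y w) - g (hybrid ∅ s x y w) =
      ∑ k ∈ s, (g (hybrid (s.filter (r · < r k)) (s.filter (r k < r ·)) x y
          (Function.update w k (x k))) -
        g (hybrid (s.filter (r · < r k)) (s.filter (r k < r ·)) x y
          (Function.update w k (y k)))) := by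
  induction s using Finset.induction_on_max_value r generalizing w with
  | empty => simp
  | insert a s ha hmax ih =>
    have hlt : ∀ p ∈ s, r p < r a := fun p hp =>
      lt_of_le_of_ne (hmax p hp) fun h => ha (hr h ▸ hp)
    rw [Finset.sum_insert ha]
    have e1 : (insert a s).filter (r · < r a) = s := by
      ext p
      simp only [Finset.mem_filter, Finset.mem_insert]
      constructor
      · rintro ⟨rfl | h, h2⟩
        · exact absurd h2 (lt_irrefl _)
        · exact h
      · exact fun h => ⟨Or.inr h, hlt p h⟩
    have e2 : (insert a s).filter (r a < r ·) = ∅ := by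
      ext p
      simp only [Finset.mem_filter, Finset.mem_insert, Finset.notMem_empty, iff_false, not_and]
      rintro (rfl | h)
      · exact lt_irrefl _
      · exact (hlt p h).le.not_gt
    have e3 : ∀ k ∈ s, ∀ v, hybrid ((insert a s).filter (r · < r k)) ((insert a s).filter (r k < r ·))
        x y (Function.update w k v) = hybrid (s.filter (r · < r k)) (s.filter (r k < r ·))
        x y (Function.update (Function.update w a (y a)) k v) := by
      intro k hk v
      ext p
      have hak : a ≠ k := fun h => ha (h ▸ hk)
      by_cases hp : p = a
      · subst hp
        simp [hybrid, ha, hlt k hk, (hlt k hk).le.not_gt, hak]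
      · simp [hybrid, hp, Function.update_apply]
    rw [e1, e2, Finset.sum_congr rfl fun k hk => by rw [e3 k hk, e3 k hk], ← ih]
    have e4 : hybrid (insert a s) ∅ x y w = hybrid s ∅ x y (Function.update w a (x a)) := by
      ext p
      by_cases hp : p = a
      · subst hp; simp [hybrid, ha]
      · simp [hybrid, hp]
    have e5 : hybrid ∅ (insert a s) x y w = hybrid ∅ s x y (Function.update w a (y a)) := by
      ext p
      by_cases hp : p = a
      · subst hp; simp [hybrid, ha]
      · simp [hybrid, hp]
    rw [e4, e5]
    ring

theorem hybrid_update {U V : Finset ι} {k : ι} (hU : k ∉ U) (hV : k ∉ V) (x y : ι → ℝ) (t : ℝ) :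
    hybrid U V x y (Function.update 0 k t) = hybrid U V x y 0 + Pi.single k t := by
  ext p
  by_cases hp : p = k
  · subst hp; simp [hybrid, hU, hV]
  · simp [hybrid, hp]

theorem hybrid_eq_add_sum {U V N : Finset ι} (hN : N ⊆ U) (hV : Disjoint U V) (x y : ι → ℝ) :
    hybrid U V x y 0 = hybrid (U \ N) V x y 0 + ∑ u ∈ N, Pi.single u (x u) := by
  ext p
  simp only [hybrid, Pi.add_apply, Finset.sum_apply, Pi.single_apply, Finset.sum_ite_eq,
    Finset.mem_sdiff, Pi.zero_apply]
  by_cases hp : p ∈ N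
  · simp [hp, hN hp, Finset.disjoint_left.mp hV (hN hp)]
  · simp [hp]

theorem measurable_hybrid {Ω : Type*} {m : MeasurableSpace Ω} {U V : Finset ι}
    {X Y : Ω → ι → ℝ} (hX : ∀ p ∈ U, Measurable fun ω => X ω p)
    (hY : ∀ p ∈ V, Measurable fun ω => Y ω p) (w : ι → ℝ) :
    Measurable fun ω => hybrid U V (X ω) (Y ω) w := by
  refine measurable_pi_iff.mpr fun p => ?_
  by_cases h : p ∈ U
  · simpa [hybrid, h] using hX p h
  · by_cases h' : p ∈ V
    · simpa [hybrid, h, h'] using hY p h'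
    · simp [hybrid, h, h']

/-- The coordinates of `N` are added one at a time. Both the uniform and the Lipschitz bound are
kept, so that small and large values of `x u` can be treated separately. -/
theorem TaylorBounds.abs_sum_single_le {f : (ι → ℝ) → ℝ} {d₁ d₂ : ι → (ι → ℝ) → ℝ}
    {c₀ c₁ c₂ c₃ : ℝ} (h : TaylorBounds f d₁ d₂ c₀ c₁ c₂ c₃) (k : ι) (N : Finset ι)
    (x z : ι → ℝ) :
    |d₂ k (z + ∑ u ∈ N, Pi.single u (x u)) - d₂ k z| ≤ ∑ u ∈ N, min (2 * c₂) (c₃ * |x u|) := by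
  induction N using Finset.induction_on with
  | empty => simp
  | insert a N ha ih =>
    rw [Finset.sum_insert ha, Finset.sum_insert ha, add_comm (Pi.single (M := fun _ => ℝ) a (x a)),
      ← add_assoc]
    refine (abs_sub_le _ (d₂ k (z + ∑ u ∈ N, Pi.single u (x u))) _).trans
      (add_le_add (le_min ?_ (h.lip₂ k a _ _)) ih)
    refine (abs_sub _ _).trans ?_
    have := h.bound₂ k (z + ∑ u ∈ N, Pi.single u (x u) + Pi.single a (x a))
    have := h.bound₂ k (z + ∑ u ∈ N, Pi.single u (x u))
    linarith

end Hybrid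

/-! ### Truncated moments and decoupling. -/

section Expectation

variable {Ω : Type*} [m0 : MeasurableSpace Ω] {μ : Measure Ω}

theorem integral_mul_eq_zero_of_indep {m₁ m₂ : MeasurableSpace Ω} (h : Indep m₁ m₂ μ)
    {W G : Ω → ℝ} (hW : Measurable[m₁] W) (hG : Measurable[m₂] G)
    (hm₁ : m₁ ≤ m0) (hm₂ : m₂ ≤ m0) (h0 : ∫ ω, W ω ∂μ = 0) : ∫ ω, W ω * G ω ∂μ = 0 := by
  have hi : IndepFun W G μ := by
    rw [IndepFun_iff_Indep]
    exact indep_of_indep_of_le_left (indep_of_indep_of_le_right h hG.comap_le) hW.comap_le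
  rw [hi.integral_fun_mul_eq_mul_integral (hW.mono hm₁ le_rfl).aestronglyMeasurable
    (hG.mono hm₂ le_rfl).aestronglyMeasurable, h0, zero_mul]

/-- The truncated second moment. -/
noncomputable def tailMoment (μ : Measure Ω) (W : Ω → ℝ) (b : ℝ) : ℝ :=
  ∫ ω in {ω | b < |W ω|}, W ω ^ 2 ∂μ

variable {W V : Ω → ℝ} {b : ℝ}

theorem tailMoment_eq (hW : Measurable W) :
    tailMoment μ W b = ∫ ω, W ω ^ 2 * Set.indicator {ω | b < |W ω|} 1 ω ∂μ := by
  rw [tailMoment, ← integral_indicator (measurableSet_lt measurable_const hW.abs)]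
  congr 1 with ω
  by_cases h : ω ∈ {ω | b < |W ω|} <;> simp [h]

theorem tailMoment_nonneg : 0 ≤ tailMoment μ W b := integral_nonneg fun _ => sq_nonneg _

theorem integrable_sq_mul_indicator (hW : MemLp W 2 μ) (hV : Measurable V) :
    Integrable (fun ω => W ω ^ 2 * Set.indicator {ω | b < |V ω|} 1 ω) μ := by
  have hm : Measurable (Set.indicator {ω | b < |V ω|} (1 : Ω → ℝ)) :=
    measurable_one.indicator (measurableSet_lt measurable_const hV.abs)
  refine hW.integrable_sq.mul_bdd (c := 1) hm.aestronglyMeasurable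
    (Eventually.of_forall fun ω => ?_)
  by_cases h : ω ∈ {ω | b < |V ω|} <;> simp [h]

/-- Where `b < |V|`, either `b < |W|` as well, or `W ^ 2 ≤ b ^ 2 < V ^ 2`. -/
theorem integral_sq_mul_indicator_le (hW : MemLp W 2 μ) (hV : MemLp V 2 μ) (hWm : Measurable W)
    (hVm : Measurable V) :
    ∫ ω, W ω ^ 2 * Set.indicator {ω | b < |V ω|} 1 ω ∂μ ≤ tailMoment μ W b + tailMoment μ V b := by
  rw [tailMoment_eq hWm, tailMoment_eq hVm, ← integral_add (integrable_sq_mul_indicator hW hWm)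
    (integrable_sq_mul_indicator hV hVm)]
  refine integral_mono (integrable_sq_mul_indicator hW hVm)
    ((integrable_sq_mul_indicator hW hWm).add (integrable_sq_mul_indicator hV hVm)) fun ω => ?_
  by_cases h1 : b < |V ω| <;> by_cases h2 : b < |W ω| <;> simp [h1, h2]
  · positivity
  · rw [sq_le_sq]
    linarith
  · positivity

variable [IsProbabilityMeasure μ]

/-- Fubini for the product law: an independent family may be frozen, and a bound uniform in its
frozen value survives integration. -/
theorem abs_integral_le_of_indepFun {A B : Type*} [MeasurableSpace A] [MeasurableSpace B]
    {x : Ω → A} {y : Ω → B} (hx : Measurable x) (hy : Measurable y) (h : IndepFun x y μ)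
    {Ψ : A → B → ℝ} (hΨ : Measurable (Function.uncurry Ψ))
    (hint : Integrable (fun ω => Ψ (x ω) (y ω)) μ) {c : ℝ}
    (hc : ∀ b, |∫ ω, Ψ (x ω) b ∂μ| ≤ c) : |∫ ω, Ψ (x ω) (y ω) ∂μ| ≤ c := by
  have hmap := (indepFun_iff_map_prod_eq_prod_map_map hx.aemeasurable hy.aemeasurable).mp h
  have hxy : Measurable fun ω => (x ω, y ω) := hx.prodMk hy
  have := Measure.isProbabilityMeasure_map (μ := μ) hx.aemeasurable
  have := Measure.isProbabilityMeasure_map (μ := μ) hy.aemeasurable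
  have hint' : Integrable (Function.uncurry Ψ) ((μ.map x).prod (μ.map y)) := by
    rw [← hmap]
    exact (integrable_map_measure hΨ.aestronglyMeasurable hxy.aemeasurable).mpr hint
  have e : ∫ ω, Ψ (x ω) (y ω) ∂μ = ∫ b, ∫ ω, Ψ (x ω) b ∂μ ∂(μ.map y) := by
    calc _ = ∫ q, Function.uncurry Ψ q ∂(μ.map fun ω => (x ω, y ω)) :=
          (integral_map hxy.aemeasurable hΨ.aestronglyMeasurable).symm
      _ = ∫ b, ∫ a, Ψ a b ∂(μ.map x) ∂(μ.map y) := by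
          rw [hmap, integral_prod_symm _ hint']; rfl
      _ = _ := by
          refine integral_congr_ae (Eventually.of_forall fun b => ?_)
          exact integral_map hx.aemeasurable
            (hΨ.comp measurable_prodMk_right).aestronglyMeasurable
  rw [e]
  have := norm_integral_le_of_norm_le_const (μ := μ.map y)
    (f := fun b => ∫ ω, Ψ (x ω) b ∂μ) (Eventually.of_forall hc)
  simpa using this

theorem abs_integral_mul_le_condExp {m : MeasurableSpace Ω} (hm : m ≤ m0) {W G : Ω → ℝ}
    (hW : Integrable W μ) (hG : StronglyMeasurable[m] G) {c : ℝ} (hc : ∀ ω, |G ω| ≤ c) :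
    |∫ ω, W ω * G ω ∂μ| ≤ c * ∫ ω, |(μ[W | m]) ω| ∂μ := by
  have hWG : Integrable (W * G) μ := hW.mul_bdd (c := c) (hG.mono hm).aestronglyMeasurable
    (Eventually.of_forall hc)
  have h1 : ∫ ω, W ω * G ω ∂μ = ∫ ω, (μ[W | m]) ω * G ω ∂μ := by
    calc _ = ∫ ω, (μ[W * G | m]) ω ∂μ := (integral_condExp hm).symm
      _ = _ := integral_congr_ae (condExp_mul_of_stronglyMeasurable_right hG hWG hW)
  rw [h1, ← integral_const_mul]
  refine (abs_integral_le_integral_abs).trans (integral_mono_of_nonneg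
    (Eventually.of_forall fun _ => abs_nonneg _) (integrable_condExp.abs.const_mul c)
    (Eventually.of_forall fun ω => ?_))
  simp only [abs_mul]
  rw [mul_comm]
  exact mul_le_mul_of_nonneg_right (hc ω) (abs_nonneg _)

theorem integral_sq_le_add_tailMoment (hW : MemLp W 2 μ) (hWm : Measurable W) (hb : 0 ≤ b) :
    ∫ ω, W ω ^ 2 ∂μ ≤ b ^ 2 + tailMoment μ W b := by
  rw [tailMoment_eq hWm]
  have : b ^ 2 + ∫ ω, W ω ^ 2 * Set.indicator {ω | b < |W ω|} 1 ω ∂μ =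
      ∫ ω, (b ^ 2 + W ω ^ 2 * Set.indicator {ω | b < |W ω|} 1 ω) ∂μ := by
    rw [integral_add (integrable_const _) (integrable_sq_mul_indicator hW hWm)]
    simp
  rw [this]
  refine integral_mono hW.integrable_sq
    ((integrable_const _).add (integrable_sq_mul_indicator hW hWm)) fun ω => ?_
  by_cases h2 : b < |W ω| <;> simp [h2]
  · positivity
  · rw [sq_le_sq, abs_of_nonneg hb]
    exact not_lt.mp h2

/-- Split `W ^ 2` at level `b`: the bounded part times the probability is handled by Chebyshev for
`V`, and the tail part uses that the probability is at most 1. -/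
theorem sq_integral_mul_indicator_le (hW : MemLp W 2 μ) (hV : MemLp V 2 μ) (hWm : Measurable W)
    (hVm : Measurable V) (hb : 0 ≤ b) :
    (∫ ω, W ω ^ 2 ∂μ) * ∫ ω, Set.indicator {ω | b < |V ω|} (1 : Ω → ℝ) ω ∂μ ≤
      tailMoment μ W b + tailMoment μ V b := by
  have hms : MeasurableSet {ω | b < |V ω|} := measurableSet_lt measurable_const hVm.abs
  have h0 : 0 ≤ ∫ ω, Set.indicator {ω | b < |V ω|} (1 : Ω → ℝ) ω ∂μ :=
    integral_nonneg fun ω => Set.indicator_nonneg (fun _ _ => zero_le_one) ω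
  have h1 : ∫ ω, Set.indicator {ω | b < |V ω|} (1 : Ω → ℝ) ω ∂μ ≤ 1 := by
    rw [integral_indicator_one hms]
    exact measureReal_le_one
  have h2 : b ^ 2 * ∫ ω, Set.indicator {ω | b < |V ω|} (1 : Ω → ℝ) ω ∂μ ≤ tailMoment μ V b := by
    rw [tailMoment_eq hVm, ← integral_const_mul]
    refine integral_mono (((integrable_const (1 : ℝ)).indicator hms).const_mul _)
      (integrable_sq_mul_indicator hV hVm) fun ω => ?_
    by_cases h : b < |V ω| <;> simp [h]
    rw [sq_le_sq, abs_of_nonneg hb]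
    exact h.le
  have h3 := integral_sq_le_add_tailMoment (μ := μ) hW hWm hb
  have h4 := tailMoment_nonneg (μ := μ) (W := W) (b := b)
  nlinarith

end Expectation

end SpectralUniversality

namespace SpectralUniversality

/-! ### One replacement in the Lindeberg scheme. -/

section Step

variable {Ω : Type*} {m m₁ mₐ : MeasurableSpace Ω} [m0 : MeasurableSpace Ω] {μ : Measure Ω}
  [IsProbabilityMeasure μ] {ι : Type*} [DecidableEq ι] [Countable ι] {X Y : ι → Ω → ℝ}

/-- With `Y` frozen, the hybrid vector depends only on the `X u` with `u ∈ U`, so `D` of it can be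
tested against the conditional expectation. It is used with `φ` the identity and with `φ` the
centered square. -/
theorem abs_integral_mul_hybrid_le (hX : ∀ p, Measurable (X p)) (hY : ∀ p, Measurable (Y p))
    (hXY : IndepFun (fun ω p => X p ω) (fun ω p => Y p ω) μ) {U V : Finset ι} {k : ι}
    {φ : ℝ → ℝ} (hφ : Measurable φ) (hint : Integrable (fun ω => φ (X k ω)) μ)
    {D : (ι → ℝ) → ℝ} (hD : Continuous D) {c : ℝ} (hc : ∀ x, |D x| ≤ c)
    (hm : m ≤ m0) (hU : ∀ u ∈ U, Measurable[m] (X u)) :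
    |∫ ω, φ (X k ω) * D (hybrid U V (fun p => X p ω) (fun p => Y p ω) 0) ∂μ| ≤
      c * ∫ ω, |(μ[fun ω => φ (X k ω) | m]) ω| ∂μ := by
  have hx : Measurable fun ω p => X p ω := measurable_pi_iff.mpr hX
  have hy : Measurable fun ω p => Y p ω := measurable_pi_iff.mpr hY
  have hD' : Measurable fun q : (ι → ℝ) × (ι → ℝ) => D (hybrid U V q.1 q.2 0) :=
    hD.measurable.comp (measurable_hybrid (fun p _ => (measurable_pi_apply p).comp measurable_fst)
      (fun p _ => (measurable_pi_apply p).comp measurable_snd) 0)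
  refine abs_integral_le_of_indepFun hx hy hXY
    (Ψ := fun x y => φ (x k) * D (hybrid U V x y 0)) ?_ ?_ fun y => ?_
  · exact (hφ.comp ((measurable_pi_apply k).comp measurable_fst)).mul hD'
  · exact hint.mul_bdd (c := c) (hD'.comp (hx.prodMk hy)).aestronglyMeasurable
      (Eventually.of_forall fun ω => hc _)
  · exact abs_integral_mul_le_condExp hm hint (hD.measurable.comp (measurable_hybrid
      (X := fun ω p => X p ω) (Y := fun _ => y) hU (fun p _ => measurable_const) 0)).stronglyMeasurable fun ω => hc _

theorem integral_mul_hybrid_eq_zero (hX : ∀ p, Measurable (X p)) (hY : ∀ p, Measurable (Y p))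
    (hXY : IndepFun (fun ω p => X p ω) (fun ω p => Y p ω) μ) {U V : Finset ι} {k : ι}
    {φ : ℝ → ℝ} (hφ : Measurable φ) (hint : Integrable (fun ω => φ (Y k ω)) μ)
    (h0 : ∫ ω, φ (Y k ω) ∂μ = 0)
    {D : (ι → ℝ) → ℝ} (hD : Continuous D) {c : ℝ} (hc : ∀ x, |D x| ≤ c)
    (hYi : Indep (MeasurableSpace.comap (Y k) inferInstance)
      (⨆ p ∈ V, MeasurableSpace.comap (Y p) inferInstance) μ) :
    ∫ ω, φ (Y k ω) * D (hybrid U V (fun p => X p ω) (fun p => Y p ω) 0) ∂μ = 0 := by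
  have hx : Measurable fun ω p => X p ω := measurable_pi_iff.mpr hX
  have hy : Measurable fun ω p => Y p ω := measurable_pi_iff.mpr hY
  have hD' : Measurable fun q : (ι → ℝ) × (ι → ℝ) => D (hybrid U V q.2 q.1 0) :=
    hD.measurable.comp (measurable_hybrid (fun p _ => (measurable_pi_apply p).comp measurable_snd)
      (fun p _ => (measurable_pi_apply p).comp measurable_fst) 0)
  refine abs_nonpos_iff.mp (abs_integral_le_of_indepFun hy hx hXY.symm
    (Ψ := fun y x => φ (y k) * D (hybrid U V x y 0)) ?_ ?_ fun x => ?_)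
  · exact (hφ.comp ((measurable_pi_apply k).comp measurable_fst)).mul hD'
  · exact hint.mul_bdd (c := c) (hD'.comp (hy.prodMk hx)).aestronglyMeasurable
      (Eventually.of_forall fun ω => hc _)
  · refine (abs_nonpos_iff.mpr ?_)
    refine integral_mul_eq_zero_of_indep hYi (W := fun ω => φ (Y k ω))
      (hφ.comp (comap_measurable _)) (hD.measurable.comp (measurable_hybrid
        (X := fun _ => x) (Y := fun ω p => Y p ω) (fun p _ => measurable_const)
        (fun p hp => ?_) 0)) (hY k).comap_le
      (iSup₂_le fun p _ => (hY p).comap_le) h0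
    exact (comap_measurable (Y p)).mono (le_iSup₂_of_le p hp le_rfl) le_rfl

-- A quadratic bound on the third-order remainder, for large increments, where `X` need not have a
-- third moment.
omit [Countable ι] in
theorem TaylorBounds.abs_remainder_le {f : (ι → ℝ) → ℝ} {d₁ d₂ : ι → (ι → ℝ) → ℝ}
    {c₀ c₁ c₂ c₃ : ℝ} (h : TaylorBounds f d₁ d₂ c₀ c₁ c₂ c₃) (k : ι) (z : ι → ℝ) (t : ℝ) :
    |f (z + Pi.single k t) - f z - t * d₁ k z - t ^ 2 / 2 * d₂ k z| ≤ 2 * c₂ * t ^ 2 := by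
  have h1 := h.taylor₂ k z t
  have h2 := TaylorBounds.mul_abs_le (le_of_eq (abs_of_nonneg (by positivity : 0 ≤ t ^ 2 / 2)))
    (h.bound₂ k z)
  have h3 := abs_sub (f (z + Pi.single k t) - f z - t * d₁ k z) (t ^ 2 / 2 * d₂ k z)
  nlinarith [(abs_nonneg _).trans (h.bound₂ k z), sq_nonneg t]

theorem min_le_add_indicator {c₂ c₃ ε b v : ℝ} (hc₂ : 0 ≤ c₂) (hc₃ : 0 ≤ c₃) (hε : 0 ≤ ε)
    (hb : c₃ * b ≤ c₂ * ε) :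
    min (2 * c₂) (c₃ * v) ≤ c₂ * ε + 2 * c₂ * Set.indicator {t | b < t} 1 v := by
  by_cases h : b < v
  · have : 0 ≤ c₂ * ε := by positivity
    simp [h, this]
  · simp only [Set.mem_ofPred_eq, h, not_false_eq_true, Set.indicator_of_notMem, mul_zero, add_zero]
    exact (min_le_right _ _).trans ((mul_le_mul_of_nonneg_left (not_lt.mp h) hc₃).trans hb)

/-- The Lindeberg condition speaks of `W` only, so the Gaussian remainder is split according to the
common standard deviation. If it is at most `2 * b`, the third moment is small compared with the
variance; otherwise the variance itself is dominated by the truncated moment of `W`. -/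
theorem exists_gaussian_remainder_bound {W V : Ω → ℝ} (hW : MemLp W 2 μ) (hWm : Measurable W)
    (hV : MemLp V 2 μ) (hV3 : Integrable (fun ω => |V ω| ^ 3) μ)
    (hsq : ∫ ω, V ω ^ 2 ∂μ = ∫ ω, W ω ^ 2 ∂μ) {C : ℝ} (hC : 0 ≤ C)
    (h3 : ∫ ω, |V ω| ^ 3 ∂μ ≤ C * Real.sqrt (∫ ω, W ω ^ 2 ∂μ) ^ 3)
    {c₂ c₃ ε b : ℝ} (hc₂ : 0 ≤ c₂) (hc₃ : 0 ≤ c₃) (hε : 0 ≤ ε) (hb : 0 ≤ b)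
    (hbc : c₃ * b ≤ c₂ * ε) :
    ∃ H : Ω → ℝ, Integrable H μ ∧ (∀ ω, min (2 * c₂ * V ω ^ 2) (c₃ * |V ω| ^ 3) ≤ H ω) ∧
      ∫ ω, H ω ∂μ ≤ c₂ * (2 * C * ε * ∫ ω, W ω ^ 2 ∂μ) + c₂ * (4 * tailMoment μ W b) := by
  set v := ∫ ω, W ω ^ 2 ∂μ with hv
  have hv0 : 0 ≤ v := integral_nonneg fun _ => sq_nonneg _
  have hT := tailMoment_nonneg (μ := μ) (W := W) (b := b)
  have hs := Real.sqrt_nonneg v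
  have hss := Real.sq_sqrt hv0
  by_cases h : Real.sqrt v ≤ 2 * b
  · refine ⟨fun ω => c₃ * |V ω| ^ 3, hV3.const_mul _, fun ω => min_le_right _ _, ?_⟩
    rw [integral_const_mul]
    have : c₃ * Real.sqrt v ≤ 2 * (c₂ * ε) :=
      (mul_le_mul_of_nonneg_left h hc₃).trans (by linarith)
    calc c₃ * ∫ ω, |V ω| ^ 3 ∂μ ≤ c₃ * (C * Real.sqrt v ^ 3) := mul_le_mul_of_nonneg_left h3 hc₃
      _ = (c₃ * Real.sqrt v) * (C * v) := by rw [← hss]; rw [Real.sqrt_sq hs]; ring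
      _ ≤ (2 * (c₂ * ε)) * (C * v) := mul_le_mul_of_nonneg_right this (by positivity)
      _ = c₂ * (2 * C * ε * v) := by ring
      _ ≤ _ := le_add_of_nonneg_right (by positivity)
  · refine ⟨fun ω => 2 * c₂ * V ω ^ 2, hV.integrable_sq.const_mul _, fun ω => min_le_left _ _, ?_⟩
    rw [integral_const_mul, hsq]
    have h1 := integral_sq_le_add_tailMoment (μ := μ) hW hWm hb
    -- Here `v > 4 * b ^ 2`, so `b ^ 2` absorbs at most a quarter of `v ≤ b ^ 2 + tailMoment μ W b`.
    have h2 : v ≤ 2 * tailMoment μ W b := by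
      rw [← hv] at h1
      push Not at h
      nlinarith
    calc 2 * c₂ * v ≤ 2 * c₂ * (2 * tailMoment μ W b) :=
          mul_le_mul_of_nonneg_left h2 (by positivity)
      _ = c₂ * (4 * tailMoment μ W b) := by ring
      _ ≤ _ := le_add_of_nonneg_left (by positivity)

/-- Replacing one entry in the Lindeberg scheme. -/
theorem lindeberg_step {f : (ι → ℝ) → ℝ} {d₁ d₂ : ι → (ι → ℝ) → ℝ} {c₀ c₁ c₂ c₃ : ℝ}
    (hf : TaylorBounds f d₁ d₂ c₀ c₁ c₂ c₃)
    (hX : ∀ p, Measurable (X p)) (hY : ∀ p, Measurable (Y p)) (hX2 : ∀ p, MemLp (X p) 2 μ)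
    (hXY : IndepFun (fun ω p => X p ω) (fun ω p => Y p ω) μ) {U V N : Finset ι} {k : ι}
    (hUV : Disjoint U V) (hN : N ⊆ U)
    (hm₁ : m₁ ≤ m0) (hmₐ : mₐ ≤ m0)
    (hU₁ : ∀ u ∈ U, Measurable[m₁] (X u)) (hUₐ : ∀ u ∈ U \ N, Measurable[mₐ] (X u))
    (hmart : μ[X k | m₁] =ᵐ[μ] 0)
    (hYi : Indep (MeasurableSpace.comap (Y k) inferInstance)
      (⨆ p ∈ V, MeasurableSpace.comap (Y p) inferInstance) μ)
    (hY0 : ∫ ω, Y k ω ∂μ = 0) (hY2 : MemLp (Y k) 2 μ)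
    (hY3 : Integrable (fun ω => |Y k ω| ^ 3) μ)
    (hYsq : ∫ ω, Y k ω ^ 2 ∂μ = ∫ ω, X k ω ^ 2 ∂μ) {C : ℝ} (hC : 0 ≤ C)
    (hYC : ∫ ω, |Y k ω| ^ 3 ∂μ ≤ C * Real.sqrt (∫ ω, X k ω ^ 2 ∂μ) ^ 3)
    {ε b : ℝ} (hε : 0 ≤ ε) (hb : 0 ≤ b) (hc₃ : 0 ≤ c₃) (hbc : c₃ * b ≤ c₂ * ε) :
    |∫ ω, (f (hybrid U V (fun p => X p ω) (fun p => Y p ω) 0 + Pi.single k (X k ω)) -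
        f (hybrid U V (fun p => X p ω) (fun p => Y p ω) 0 + Pi.single k (Y k ω))) ∂μ| ≤
      c₂ * (1 / 2 * (∫ ω, |(μ[fun ω => X k ω ^ 2 - ∫ ω', X k ω' ^ 2 ∂μ | mₐ]) ω| ∂μ)
        + ε * (1 + 2 * C + N.card) * (∫ ω, X k ω ^ 2 ∂μ)
        + (6 + 2 * N.card) * tailMoment μ (X k) b + 2 * ∑ u ∈ N, tailMoment μ (X u) b) := by
  set v := ∫ ω, X k ω ^ 2 ∂μ with hv
  have hv0 : 0 ≤ v := integral_nonneg fun _ => sq_nonneg _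
  have hc₂ : 0 ≤ c₂ := (abs_nonneg _).trans (hf.bound₂ k 0)
  set Z : Ω → ι → ℝ := fun ω => hybrid U V (fun p => X p ω) (fun p => Y p ω) 0 with hZ
  -- The entries of `X` near `k` are set to zero, so that the rest of the `X` part is measurable for
  -- `mₐ`.
  set Za : Ω → ι → ℝ := fun ω => hybrid (U \ N) V (fun p => X p ω) (fun p => Y p ω) 0 with hZa
  have hZm : Measurable Z := measurable_hybrid (fun p _ => hX p) (fun p _ => hY p) 0
  have hZam : Measurable Za := measurable_hybrid (fun p _ => hX p) (fun p _ => hY p) 0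
  have hsingle : Measurable fun t : ℝ => (Pi.single k t : ι → ℝ) := by
    refine measurable_pi_iff.mpr fun p => ?_
    by_cases h : p = k
    · subst h; simpa using measurable_id'
    · simp [h]
  have hXi : Integrable (X k) μ := (hX2 k).integrable one_le_two
  have hYi1 : Integrable (Y k) μ := hY2.integrable one_le_two
  have hXc : Integrable (fun ω => X k ω ^ 2 - v) μ :=
    (hX2 k).integrable_sq.sub (integrable_const _)
  have hYc : Integrable (fun ω => Y k ω ^ 2 - v) μ := hY2.integrable_sq.sub (integrable_const _)
  have hd₁Z : AEStronglyMeasurable (fun ω => d₁ k (Z ω)) μ :=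
    ((hf.cont₁ k).measurable.comp hZm).aestronglyMeasurable
  have hd₂Z : AEStronglyMeasurable (fun ω => d₂ k (Z ω)) μ :=
    ((hf.cont₂ k).measurable.comp hZm).aestronglyMeasurable
  have hd₂Za : AEStronglyMeasurable (fun ω => d₂ k (Za ω)) μ :=
    ((hf.cont₂ k).measurable.comp hZam).aestronglyMeasurable
  have iA : Integrable (fun ω => X k ω * d₁ k (Z ω)) μ :=
    hXi.mul_bdd (c := c₁) hd₁Z (Eventually.of_forall fun ω => hf.bound₁ k _)
  have iB : Integrable (fun ω => Y k ω * d₁ k (Z ω)) μ :=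
    hYi1.mul_bdd (c := c₁) hd₁Z (Eventually.of_forall fun ω => hf.bound₁ k _)
  have iC : Integrable (fun ω => (X k ω ^ 2 - v) * d₂ k (Za ω)) μ :=
    hXc.mul_bdd (c := c₂) hd₂Za (Eventually.of_forall fun ω => hf.bound₂ k _)
  have iE : Integrable (fun ω => (Y k ω ^ 2 - v) * d₂ k (Z ω)) μ :=
    hYc.mul_bdd (c := c₂) hd₂Z (Eventually.of_forall fun ω => hf.bound₂ k _)
  have ifb : ∀ g : Ω → ι → ℝ, Measurable g → Integrable (fun ω => f (g ω)) μ := fun g hg =>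
    Integrable.of_bound (hf.cont.measurable.comp hg).aestronglyMeasurable c₀
      (Eventually.of_forall fun ω => hf.bound _)
  have iF : Integrable (fun ω => f (Z ω + Pi.single k (X k ω)) - f (Z ω + Pi.single k (Y k ω))) μ :=
    (ifb _ (hZm.add (hsingle.comp (hX k)))).sub (ifb _ (hZm.add (hsingle.comp (hY k))))
  have eA : ∫ ω, X k ω * d₁ k (Z ω) ∂μ = 0 := by
    have h := abs_integral_mul_hybrid_le (V := V) hX hY hXY measurable_id hXi (hf.cont₁ k)
      (hf.bound₁ k) hm₁ hU₁
    have h0 : ∫ ω, |(μ[fun ω => id (X k ω) | m₁]) ω| ∂μ = 0 := by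
      rw [integral_congr_ae (g := fun _ => (0 : ℝ)), integral_zero]
      filter_upwards [hmart] with ω hω
      simpa using hω
    rw [h0, mul_zero] at h
    exact abs_nonpos_iff.mp h
  have eB : ∫ ω, Y k ω * d₁ k (Z ω) ∂μ = 0 :=
    integral_mul_hybrid_eq_zero hX hY hXY measurable_id hYi1 hY0 (hf.cont₁ k) (hf.bound₁ k) hYi
  have eE : ∫ ω, (Y k ω ^ 2 - v) * d₂ k (Z ω) ∂μ = 0 := by
    refine integral_mul_hybrid_eq_zero hX hY hXY (φ := fun t => t ^ 2 - v) (by fun_prop) hYc ?_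
      (hf.cont₂ k) (hf.bound₂ k) hYi
    rw [integral_sub hY2.integrable_sq (integrable_const _), hYsq]
    simp
  have eC := abs_integral_mul_hybrid_le (V := V) hX hY hXY (φ := fun t => t ^ 2 - v) (by fun_prop)
    hXc (hf.cont₂ k) (hf.bound₂ k) hmₐ hUₐ
  obtain ⟨HY, iHY, hHY, eHY⟩ := exists_gaussian_remainder_bound (hX2 k) (hX k) hY2 hY3 hYsq hC hYC
    hc₂ hc₃ hε hb hbc
  -- The terms whose expectation vanishes or is controlled by conditioning are taken out. The
  -- remainder is estimated in absolute value, pointwise.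
  set rest : Ω → ℝ := fun ω => (f (Z ω + Pi.single k (X k ω)) - f (Z ω + Pi.single k (Y k ω)))
    - X k ω * d₁ k (Z ω) + Y k ω * d₁ k (Z ω) - 1 / 2 * ((X k ω ^ 2 - v) * d₂ k (Za ω))
    + 1 / 2 * ((Y k ω ^ 2 - v) * d₂ k (Z ω)) with hrest
  set I : ι → Ω → ℝ := fun u => Set.indicator {ω | b < |X u ω|} 1 with hI
  have iI : ∀ u, Integrable (I u) μ := fun u =>
    (integrable_const (1 : ℝ)).indicator (measurableSet_lt measurable_const (hX u).abs)
  have iXI : ∀ u, Integrable (fun ω => X k ω ^ 2 * I u ω) μ := fun u =>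
    integrable_sq_mul_indicator (hX2 k) (hX u)
  have iS : ∀ u, Integrable (fun ω => 1 / 2 * (c₂ * ε) * (X k ω ^ 2 + v) +
      c₂ * (X k ω ^ 2 * I u ω + v * I u ω)) μ := fun u =>
    (((hX2 k).integrable_sq.add (integrable_const v)).const_mul _).add
      (((iXI u).add ((iI u).const_mul v)).const_mul _)
  have iXk : Integrable (fun ω => c₂ * ε * X k ω ^ 2 + 2 * c₂ * (X k ω ^ 2 * I k ω)) μ :=
    ((hX2 k).integrable_sq.const_mul _).add ((iXI k).const_mul _)
  set H : Ω → ℝ := fun ω => (∑ u ∈ N, (1 / 2 * (c₂ * ε) * (X k ω ^ 2 + v) +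
      c₂ * (X k ω ^ 2 * I u ω + v * I u ω))) +
      (c₂ * ε * X k ω ^ 2 + 2 * c₂ * (X k ω ^ 2 * I k ω)) + HY ω with hH
  have iSum : Integrable (fun ω => ∑ u ∈ N, (1 / 2 * (c₂ * ε) * (X k ω ^ 2 + v) +
      c₂ * (X k ω ^ 2 * I u ω + v * I u ω))) μ := integrable_finsetSum N fun u _ => iS u
  have iH : Integrable H μ := (iSum.add iXk).add iHY
  have hmin : ∀ u ω, min (2 * c₂) (c₃ * |X u ω|) ≤ c₂ * ε + 2 * c₂ * I u ω := fun u ω =>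
    min_le_add_indicator hc₂ hc₃ hε hbc
  have hpt : ∀ ω, |rest ω| ≤ H ω := by
    intro ω
    have hX2' := sq_nonneg (X k ω)
    have h1 : |f (Z ω + Pi.single k (X k ω)) - f (Z ω) - X k ω * d₁ k (Z ω)
        - X k ω ^ 2 / 2 * d₂ k (Z ω)| ≤ c₂ * ε * X k ω ^ 2 + 2 * c₂ * (X k ω ^ 2 * I k ω) := by
      have ha := hf.abs_remainder_le k (Z ω) (X k ω)
      have hb := hf.taylor₃ k (Z ω) (X k ω)
      calc _ ≤ min (2 * c₂ * X k ω ^ 2) (c₃ * |X k ω| ^ 3) := le_min ha hb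
        _ = min (2 * c₂) (c₃ * |X k ω|) * X k ω ^ 2 := by
          rw [min_mul_of_nonneg _ _ hX2', mul_assoc c₃, ← sq_abs (X k ω)]; ring_nf
        _ ≤ (c₂ * ε + 2 * c₂ * I k ω) * X k ω ^ 2 := mul_le_mul_of_nonneg_right (hmin k ω) hX2'
        _ = _ := by ring
    have h2 : |f (Z ω + Pi.single k (Y k ω)) - f (Z ω) - Y k ω * d₁ k (Z ω)
        - Y k ω ^ 2 / 2 * d₂ k (Z ω)| ≤ HY ω :=
      (le_min (hf.abs_remainder_le k (Z ω) (Y k ω)) (hf.taylor₃ k (Z ω) (Y k ω))).trans (hHY ω)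
    -- The cost of passing from `Z` to `Za`. Bounding `|X k ω ^ 2 - v|` by the sum creates the
    -- products `v * I u ω`, integrated later by `sq_integral_mul_indicator_le`.
    have h3 : |1 / 2 * ((X k ω ^ 2 - v) * (d₂ k (Z ω) - d₂ k (Za ω)))| ≤
        ∑ u ∈ N, (1 / 2 * (c₂ * ε) * (X k ω ^ 2 + v) + c₂ * (X k ω ^ 2 * I u ω + v * I u ω)) := by
      have ha : |X k ω ^ 2 - v| ≤ X k ω ^ 2 + v := by
        rw [abs_le]; constructor <;> linarith
      have hb' : |d₂ k (Z ω) - d₂ k (Za ω)| ≤ ∑ u ∈ N, (c₂ * ε + 2 * c₂ * I u ω) := by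
        have := hf.abs_sum_single_le k N (fun p => X p ω) (Za ω)
        rw [← hybrid_eq_add_sum hN hUV] at this
        exact this.trans (Finset.sum_le_sum fun u _ => hmin u ω)
      rw [abs_mul, abs_of_pos (by norm_num : (0 : ℝ) < 1 / 2)]
      refine (mul_le_mul_of_nonneg_left (TaylorBounds.mul_abs_le ha hb')
        (by norm_num : (0 : ℝ) ≤ 1 / 2)).trans_eq ?_
      rw [Finset.mul_sum, Finset.mul_sum]
      refine Finset.sum_congr rfl fun u _ => ?_
      ring
    -- The terms with `v * d₂ k (Z ω)` match because both variables have variance `v`.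
    have e : rest ω = 1 / 2 * ((X k ω ^ 2 - v) * (d₂ k (Z ω) - d₂ k (Za ω))) +
        (f (Z ω + Pi.single k (X k ω)) - f (Z ω) - X k ω * d₁ k (Z ω)
          - X k ω ^ 2 / 2 * d₂ k (Z ω)) -
        (f (Z ω + Pi.single k (Y k ω)) - f (Z ω) - Y k ω * d₁ k (Z ω)
          - Y k ω ^ 2 / 2 * d₂ k (Z ω)) := by
      simp only [hrest]; ring
    rw [e]
    exact (abs_sub _ _).trans (add_le_add ((abs_add_le _ _).trans (add_le_add h3 h1)) h2)
  have irest : Integrable rest μ :=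
    (((iF.sub iA).add iB).sub (iC.const_mul _)).add (iE.const_mul _)
  have erest : ∫ ω, rest ω ∂μ =
      (∫ ω, (f (Z ω + Pi.single k (X k ω)) - f (Z ω + Pi.single k (Y k ω))) ∂μ)
        - 1 / 2 * ∫ ω, (X k ω ^ 2 - v) * d₂ k (Za ω) ∂μ := by
    simp only [hrest]
    have j1 : Integrable (fun ω => f (Z ω + Pi.single k (X k ω)) - f (Z ω + Pi.single k (Y k ω))
      - X k ω * d₁ k (Z ω)) μ := iF.sub iA
    have j2 : Integrable (fun ω => f (Z ω + Pi.single k (X k ω)) - f (Z ω + Pi.single k (Y k ω))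
      - X k ω * d₁ k (Z ω) + Y k ω * d₁ k (Z ω)) μ := j1.add iB
    have j3 : Integrable (fun ω => f (Z ω + Pi.single k (X k ω)) - f (Z ω + Pi.single k (Y k ω))
      - X k ω * d₁ k (Z ω) + Y k ω * d₁ k (Z ω) - 1 / 2 * ((X k ω ^ 2 - v) * d₂ k (Za ω))) μ :=
      j2.sub (iC.const_mul _)
    rw [integral_add j3 (iE.const_mul _), integral_sub j2 (iC.const_mul _), integral_add j1 iB,
      integral_sub iF iA, integral_const_mul, integral_const_mul, eA, eB, eE]
    ring
  have hHint : ∫ ω, H ω ∂μ ≤ (∑ u ∈ N, c₂ * (ε * v + 2 * tailMoment μ (X k) b +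
      2 * tailMoment μ (X u) b)) + (c₂ * ε * v + 2 * c₂ * tailMoment μ (X k) b) +
      (c₂ * (2 * C * ε * v) + c₂ * (4 * tailMoment μ (X k) b)) := by
    simp only [hH]
    have j1 : Integrable (fun ω => ∑ u ∈ N, (1 / 2 * (c₂ * ε) * (X k ω ^ 2 + v) +
      c₂ * (X k ω ^ 2 * I u ω + v * I u ω)) +
      (c₂ * ε * X k ω ^ 2 + 2 * c₂ * (X k ω ^ 2 * I k ω))) μ := iSum.add iXk
    rw [integral_add j1 iHY, integral_add iSum iXk, integral_finsetSum _ fun u _ => iS u]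
    refine add_le_add (add_le_add (Finset.sum_le_sum fun u _ => ?_) ?_) eHY
    · have j2 : Integrable (fun ω => 1 / 2 * (c₂ * ε) * (X k ω ^ 2 + v)) μ :=
        ((hX2 k).integrable_sq.add (integrable_const v)).const_mul _
      have j3 : Integrable (fun ω => c₂ * (X k ω ^ 2 * I u ω + v * I u ω)) μ :=
        ((iXI u).add ((iI u).const_mul v)).const_mul _
      rw [integral_add j2 j3, integral_const_mul, integral_const_mul,
        integral_add (hX2 k).integrable_sq (integrable_const v),
        integral_add (iXI u) ((iI u).const_mul v), integral_const_mul, ← hv]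
      have h1 := integral_sq_mul_indicator_le (b := b) (hX2 k) (hX2 u) (hX k) (hX u)
      have h2 := sq_integral_mul_indicator_le (hX2 k) (hX2 u) (hX k) (hX u) hb
      rw [← hv] at h2
      simp only [integral_const, probReal_univ, smul_eq_mul, one_mul]
      have := mul_le_mul_of_nonneg_left (add_le_add h1 h2) hc₂
      refine (add_le_add_right this _).trans_eq ?_
      ring
    · rw [integral_add ((hX2 k).integrable_sq.const_mul _) ((iXI k).const_mul _),
        integral_const_mul, integral_const_mul, ← hv, tailMoment_eq (hX k)]
  have habs : |∫ ω, rest ω ∂μ| ≤ ∫ ω, H ω ∂μ :=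
    abs_integral_le_integral_abs.trans (integral_mono irest.abs iH hpt)
  have e2 : ∫ ω, (f (Z ω + Pi.single k (X k ω)) - f (Z ω + Pi.single k (Y k ω))) ∂μ =
      ∫ ω, rest ω ∂μ + 1 / 2 * ∫ ω, (X k ω ^ 2 - v) * d₂ k (Za ω) ∂μ := by
    rw [erest]; ring
  rw [e2]
  refine (abs_add_le _ _).trans ((add_le_add (habs.trans hHint) (?_ :
    _ ≤ 1 / 2 * (c₂ * ∫ ω, |(μ[fun ω => X k ω ^ 2 - v | mₐ]) ω| ∂μ))).trans_eq ?_)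
  · rw [abs_mul, abs_of_pos (by norm_num : (0 : ℝ) < 1 / 2)]
    exact mul_le_mul_of_nonneg_left eC (by norm_num)
  · rw [← Finset.mul_sum, Finset.sum_add_distrib, Finset.sum_const, ← Finset.mul_sum,
      nsmul_eq_mul]
    ring

end Step

end SpectralUniversality

namespace SpectralUniversality

theorem TaylorBounds.mono {ι : Type*} [DecidableEq ι] {f : (ι → ℝ) → ℝ}
    {d₁ d₂ : ι → (ι → ℝ) → ℝ} {c₀ c₁ c₂ c₃ c₀' c₁' c₂' c₃' : ℝ}
    (h : TaylorBounds f d₁ d₂ c₀ c₁ c₂ c₃) (h₀ : c₀ ≤ c₀') (h₁ : c₁ ≤ c₁') (h₂ : c₂ ≤ c₂')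
    (h₃ : c₃ ≤ c₃') : TaylorBounds f d₁ d₂ c₀' c₁' c₂' c₃' where
  cont := h.cont
  cont₁ := h.cont₁
  cont₂ := h.cont₂
  bound x := (h.bound x).trans h₀
  bound₁ k x := (h.bound₁ k x).trans h₁
  bound₂ k x := (h.bound₂ k x).trans h₂
  lip k x t := (h.lip k x t).trans (mul_le_mul_of_nonneg_right h₁ (abs_nonneg t))
  lip₁ k u x t := (h.lip₁ k u x t).trans (mul_le_mul_of_nonneg_right h₂ (abs_nonneg t))
  lip₂ k u x t := (h.lip₂ k u x t).trans (mul_le_mul_of_nonneg_right h₃ (abs_nonneg t))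
  taylor₂ k x t := (h.taylor₂ k x t).trans (mul_le_mul_of_nonneg_right h₂ (sq_nonneg t))
  taylor₃ k x t := (h.taylor₃ k x t).trans (mul_le_mul_of_nonneg_right h₃ (by positivity))

/-! ### Moments of centered Gaussian variables. -/

section Gaussian

/-- Scaling, valid also for variance 0, expresses all third absolute moments through a single
constant. -/
theorem gaussianReal_zero_eq_map (v : ℝ) (hv : 0 ≤ v) :
    gaussianReal 0 v.toNNReal = (gaussianReal 0 1).map (Real.sqrt v * ·) := by
  rw [gaussianReal_map_const_mul]
  congr 1
  · simp
  · ext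
    simp [Real.sq_sqrt hv, hv]

/-- The third absolute moment of a standard Gaussian variable. -/
noncomputable def gaussianThirdMoment : ℝ := ∫ x, |x| ^ 3 ∂(gaussianReal 0 1)

theorem gaussianThirdMoment_nonneg : 0 ≤ gaussianThirdMoment :=
  integral_nonneg fun _ => by positivity

variable {Ω : Type*} [MeasurableSpace Ω] {μ : Measure Ω} {W : Ω → ℝ} {v : ℝ}

theorem memLp_of_map_gaussianReal (hW : Measurable W)
    (h : μ.map W = gaussianReal 0 v.toNNReal) (p : NNReal) : MemLp W p μ := by
  have h1 := memLp_id_gaussianReal (μ := 0) (v := v.toNNReal) p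
  rw [← h] at h1
  exact (memLp_map_measure_iff aestronglyMeasurable_id hW.aemeasurable).mp h1

theorem integral_of_map_gaussianReal (hW : Measurable W)
    (h : μ.map W = gaussianReal 0 v.toNNReal) : ∫ ω, W ω ∂μ = 0 := by
  have h1 := integral_id_gaussianReal (μ := 0) (v := v.toNNReal)
  rw [← h, integral_map hW.aemeasurable (by fun_prop)] at h1
  exact h1

theorem integral_sq_of_map_gaussianReal (hW : Measurable W) (hv : 0 ≤ v)
    (h : μ.map W = gaussianReal 0 v.toNNReal) : ∫ ω, W ω ^ 2 ∂μ = v := by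
  have h1 := variance_fun_id_gaussianReal (μ := 0) (v := v.toNNReal)
  rw [variance_eq_integral (by fun_prop), integral_id_gaussianReal, ← h,
    integral_map hW.aemeasurable (by fun_prop)] at h1
  simpa [hv] using h1

theorem integral_abs_pow_three_of_map_gaussianReal (hW : Measurable W) (hv : 0 ≤ v)
    (h : μ.map W = gaussianReal 0 v.toNNReal) :
    ∫ ω, |W ω| ^ 3 ∂μ = gaussianThirdMoment * Real.sqrt v ^ 3 := by
  calc _ = ∫ x, |x| ^ 3 ∂(μ.map W) := by rw [integral_map hW.aemeasurable (by fun_prop)]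
    _ = ∫ x, |Real.sqrt v * x| ^ 3 ∂(gaussianReal 0 1) := by
      rw [h, gaussianReal_zero_eq_map v hv, integral_map (by fun_prop) (by fun_prop)]
    _ = ∫ x, |x| ^ 3 * Real.sqrt v ^ 3 ∂(gaussianReal 0 1) := by
      refine integral_congr_ae (Eventually.of_forall fun x => ?_)
      simp only [abs_mul, abs_of_nonneg (Real.sqrt_nonneg v)]
      ring
    _ = _ := integral_mul_const _ _

end Gaussian

/-! ### Boxes and the lexicographic past. -/

/-- The indices at sup-distance at most `a` from `k`. -/
noncomputable def box (a : ℕ) (k : ℤ × ℤ) : Finset (ℤ × ℤ) :=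
  Finset.Icc (k.1 - a) (k.1 + a) ×ˢ Finset.Icc (k.2 - a) (k.2 + a)

theorem card_box (a : ℕ) (k : ℤ × ℤ) : (box a k).card = (2 * a + 1) ^ 2 := by
  rw [box, Finset.card_product, Int.card_Icc, Int.card_Icc, pow_two]
  congr 1 <;> omega

theorem mem_box_comm {a : ℕ} {k u : ℤ × ℤ} : u ∈ box a k ↔ k ∈ box a u := by
  simp only [box, Finset.mem_product, Finset.mem_Icc]
  constructor <;> intro h <;> omega

theorem mem_indexPast_of_lt {k u : ℤ × ℤ} (h : toLex u < toLex k) : u ∈ indexPast 1 k := by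
  rw [Prod.Lex.toLex_lt_toLex] at h
  refine ⟨?_, h.imp_right fun h => ⟨h.1, h.2.le⟩⟩
  rw [le_max_iff, Nat.cast_one]
  rcases h with h | h
  · left; rw [le_abs]; omega
  · right; rw [le_abs]; omega

/-- The box contains distance exactly `a`, so its complement is at distance greater than `a`,
slightly more than the past requires. -/
theorem mem_indexPast_of_lt_of_notMem_box {a : ℕ} {k u : ℤ × ℤ} (h : toLex u < toLex k)
    (h' : u ∉ box a k) : u ∈ indexPast a k := by
  rw [Prod.Lex.toLex_lt_toLex] at h
  refine ⟨?_, h.imp_right fun h => ⟨h.1, h.2.le⟩⟩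
  simp only [box, Finset.mem_product, Finset.mem_Icc] at h'
  rw [le_max_iff, le_abs, le_abs]
  omega

/-! ### Summing the replacements over the triangle. -/

section Comparison

variable {Ω : Type*} [m0 : MeasurableSpace Ω] {μ : Measure Ω} [IsProbabilityMeasure μ]
  {X Y : ℤ × ℤ → Ω → ℝ}

theorem past_le (hX : ∀ p, Measurable (X p)) (a : ℕ) (p : ℤ × ℤ) : past X a p ≤ m0 :=
  iSup₂_le fun q _ => (hX q).comap_le

omit m0 in
theorem measurable_past {a : ℕ} {p q : ℤ × ℤ} (hq : q ∈ indexPast a p) (hq' : q.2 ≤ q.1) :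
    Measurable[past X a p] (X q) :=
  (comap_measurable (X q)).mono
    (le_iSup₂_of_le (f := fun q (_ : q ∈ {q | q ∈ indexPast a p ∧ q.2 ≤ q.1}) =>
      MeasurableSpace.comap (X q) inferInstance) q ⟨hq, hq'⟩ le_rfl) le_rfl

theorem mem_lowerTriangle {n : ℕ} {p : ℤ × ℤ} :
    p ∈ lowerTriangle n ↔ 1 ≤ p.2 ∧ p.2 ≤ p.1 ∧ p.1 ≤ n := by
  simp only [lowerTriangle, Finset.mem_filter, Finset.mem_product, Finset.mem_Icc]
  omega

theorem lindeberg_comparison {f : (ℤ × ℤ → ℝ) → ℝ} {d₁ d₂ : ℤ × ℤ → (ℤ × ℤ → ℝ) → ℝ}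
    {c₀ c₁ c₂ c₃ : ℝ} (hf : TaylorBounds f d₁ d₂ c₀ c₁ c₂ c₃) {n : ℕ}
    (hfc : ∀ x x' : ℤ × ℤ → ℝ, (∀ p ∈ lowerTriangle n, x p = x' p) → f x = f x')
    (hX : ∀ p, Measurable (X p)) (hY : ∀ p, Measurable (Y p)) (hX2 : ∀ p, MemLp (X p) 2 μ)
    (hXY : IndepFun (fun ω p => X p ω) (fun ω p => Y p ω) μ)
    (hmart : ∀ i j : ℤ, 1 ≤ j → j ≤ i → μ[X (i, j) | past X 1 (i, j)] =ᵐ[μ] 0)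
    (hYi : ∀ k ∈ lowerTriangle n, ∀ V ⊆ lowerTriangle n, k ∉ V →
      Indep (MeasurableSpace.comap (Y k) inferInstance)
        (⨆ p ∈ V, MeasurableSpace.comap (Y p) inferInstance) μ)
    (hYg : ∀ k ∈ lowerTriangle n, μ.map (Y k) = gaussianReal 0 (sigmaSq μ X k).toNNReal)
    {ε b : ℝ} (hε : 0 ≤ ε) (hb : 0 ≤ b) (hc₃ : 0 ≤ c₃) (hbc : c₃ * b ≤ c₂ * ε) (a : ℕ) :
    |∫ ω, f (fun p => X p ω) ∂μ - ∫ ω, f (fun p => Y p ω) ∂μ| ≤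
      c₂ * (1 / 2 * (∑ k ∈ lowerTriangle n,
          ∫ ω, |(μ[fun ω => X k ω ^ 2 - sigmaSq μ X k | past X a k]) ω| ∂μ)
        + ε * (1 + 2 * gaussianThirdMoment + (2 * a + 1) ^ 2) *
          ∑ k ∈ lowerTriangle n, sigmaSq μ X k
        + (6 + 4 * (2 * a + 1) ^ 2) * ∑ k ∈ lowerTriangle n, tailMoment μ (X k) b) := by
  set s := lowerTriangle n with hs
  have hc₂ : 0 ≤ c₂ := (abs_nonneg _).trans (hf.bound₂ 0 0)
  set U : ℤ × ℤ → Finset (ℤ × ℤ) := fun k => s.filter (toLex · < toLex k) with hU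
  set V : ℤ × ℤ → Finset (ℤ × ℤ) := fun k => s.filter (toLex k < toLex ·) with hV
  set N : ℤ × ℤ → Finset (ℤ × ℤ) := fun k => (U k).filter (· ∈ box a k) with hN
  have hUk : ∀ k, k ∉ U k := fun k => by simp [hU]
  have hVk : ∀ k, k ∉ V k := fun k => by simp [hV]
  have ifb : ∀ g : Ω → ℤ × ℤ → ℝ, Measurable g → Integrable (fun ω => f (g ω)) μ := fun g hg =>
    Integrable.of_bound (hf.cont.measurable.comp hg).aestronglyMeasurable c₀
      (Eventually.of_forall fun ω => hf.bound _)
  set Z : ℤ × ℤ → Ω → ℤ × ℤ → ℝ :=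
    fun k ω => hybrid (U k) (V k) (fun p => X p ω) (fun p => Y p ω) 0 with hZ
  have hZm : ∀ k, Measurable (Z k) := fun k =>
    measurable_hybrid (fun p _ => hX p) (fun p _ => hY p) 0
  have hsingle : ∀ k, Measurable fun t : ℝ => (Pi.single k t : ℤ × ℤ → ℝ) := by
    refine fun k => measurable_pi_iff.mpr fun p => ?_
    by_cases h : p = k
    · subst h; simpa using measurable_id'
    · simp [h]
  have htel : ∀ ω, f (fun p => X p ω) - f (fun p => Y p ω) =
      ∑ k ∈ s, (f (Z k ω + Pi.single k (X k ω)) - f (Z k ω + Pi.single k (Y k ω))) := by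
    intro ω
    have h := hybrid_telescope (r := toLex) toLex.injective f s (fun p => X p ω)
      (fun p => Y p ω) 0
    -- Off the triangle the hybrid vectors are zero, which `f` does not see.
    rw [hfc (hybrid s ∅ _ _ 0) (fun p => X p ω) fun p hp => by simp [hybrid, hp],
      hfc (hybrid ∅ s _ _ 0) (fun p => Y p ω) fun p hp => by simp [hybrid, hp]] at h
    rw [h]
    refine Finset.sum_congr rfl fun k _ => ?_
    rw [hybrid_update (hUk k) (hVk k), hybrid_update (hUk k) (hVk k)]
  have hint : ∫ ω, f (fun p => X p ω) ∂μ - ∫ ω, f (fun p => Y p ω) ∂μ =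
      ∑ k ∈ s, ∫ ω, (f (Z k ω + Pi.single k (X k ω)) - f (Z k ω + Pi.single k (Y k ω))) ∂μ := by
    rw [← integral_sub (ifb _ (measurable_pi_iff.mpr hX)) (ifb _ (measurable_pi_iff.mpr hY)),
      ← integral_finsetSum]
    · exact integral_congr_ae (Eventually.of_forall htel)
    · exact fun k _ => (ifb _ ((hZm k).add ((hsingle k).comp (hX k)))).sub
        (ifb _ ((hZm k).add ((hsingle k).comp (hY k))))
  have hcard : ∀ k, ((N k).card : ℝ) ≤ (2 * a + 1) ^ 2 := by
    intro k
    have : (N k).card ≤ (box a k).card :=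
      Finset.card_le_card fun u hu => (Finset.mem_filter.mp hu).2
    rw [card_box] at this
    exact_mod_cast this
  have hstep : ∀ k ∈ s,
      |∫ ω, (f (Z k ω + Pi.single k (X k ω)) - f (Z k ω + Pi.single k (Y k ω))) ∂μ| ≤
      c₂ * (1 / 2 * (∫ ω, |(μ[fun ω => X k ω ^ 2 - sigmaSq μ X k | past X a k]) ω| ∂μ)
        + ε * (1 + 2 * gaussianThirdMoment + (2 * a + 1) ^ 2) * sigmaSq μ X k
        + (6 + 2 * (2 * a + 1) ^ 2) * tailMoment μ (X k) b
        + 2 * ∑ u ∈ N k, tailMoment μ (X u) b) := by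
    intro k hk
    have hk' := mem_lowerTriangle.mp hk
    have hv : 0 ≤ sigmaSq μ X k := integral_nonneg fun _ => sq_nonneg _
    have hY3 := (memLp_of_map_gaussianReal (hY k) (hYg k hk) 3).integrable_norm_pow (p := 3)
      (by norm_num)
    refine (lindeberg_step hf hX hY hX2 hXY (N := N k) (m₁ := past X 1 k) (mₐ := past X a k)
      (C := gaussianThirdMoment) ?_ (Finset.filter_subset _ _)
      (past_le hX _ _) (past_le hX _ _) ?_ ?_ (hmart k.1 k.2 hk'.1 hk'.2.1) (hYi k hk (V k)
      (Finset.filter_subset _ _) (hVk k)) (integral_of_map_gaussianReal (hY k) (hYg k hk))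
      (memLp_of_map_gaussianReal (hY k) (hYg k hk) 2) hY3
      (integral_sq_of_map_gaussianReal (hY k) hv (hYg k hk)) gaussianThirdMoment_nonneg
      (integral_abs_pow_three_of_map_gaussianReal (hY k) hv (hYg k hk)).le hε hb hc₃ hbc).trans ?_
    · rw [Finset.disjoint_left]
      intro u hu hu'
      exact lt_asymm (Finset.mem_filter.mp hu).2 (Finset.mem_filter.mp hu').2
    · intro u hu
      exact measurable_past (mem_indexPast_of_lt (Finset.mem_filter.mp hu).2)
        (mem_lowerTriangle.mp (Finset.mem_filter.mp hu).1).2.1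
    · intro u hu
      rw [Finset.mem_sdiff] at hu
      have hu1 := Finset.mem_filter.mp hu.1
      refine measurable_past (mem_indexPast_of_lt_of_notMem_box hu1.2 fun h => hu.2 ?_)
        (mem_lowerTriangle.mp hu1.1).2.1
      exact Finset.mem_filter.mpr ⟨hu.1, h⟩
    · refine mul_le_mul_of_nonneg_left (add_le_add_left (add_le_add (add_le_add le_rfl ?_) ?_) _)
        hc₂
      · refine mul_le_mul_of_nonneg_right (mul_le_mul_of_nonneg_left ?_ hε) hv
        linarith [hcard k]
      · refine mul_le_mul_of_nonneg_right ?_ tailMoment_nonneg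
        linarith [hcard k]
  -- Box membership is symmetric, so after exchanging the sums each truncated moment is counted at
  -- most `(2 * a + 1) ^ 2` times. Hence the coefficient 4 instead of 2 in the total.
  have hdouble : ∑ k ∈ s, ∑ u ∈ N k, tailMoment μ (X u) b ≤
      (2 * a + 1) ^ 2 * ∑ k ∈ s, tailMoment μ (X k) b := by
    calc _ ≤ ∑ k ∈ s, ∑ u ∈ s, if u ∈ box a k then tailMoment μ (X u) b else 0 := by
          refine Finset.sum_le_sum fun k _ => ?_
          rw [← Finset.sum_filter]
          refine Finset.sum_le_sum_of_subset_of_nonneg (fun u hu => ?_)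
            fun _ _ _ => tailMoment_nonneg
          have h1 := Finset.mem_filter.mp hu
          exact Finset.mem_filter.mpr ⟨(Finset.mem_filter.mp h1.1).1, h1.2⟩
      _ = ∑ u ∈ s, ∑ k ∈ s, if u ∈ box a k then tailMoment μ (X u) b else 0 := Finset.sum_comm
      _ ≤ ∑ u ∈ s, (2 * a + 1) ^ 2 * tailMoment μ (X u) b := by
          refine Finset.sum_le_sum fun u _ => ?_
          rw [← Finset.sum_filter, Finset.sum_const, nsmul_eq_mul]
          refine mul_le_mul_of_nonneg_right ?_ tailMoment_nonneg
          have : (s.filter fun k => u ∈ box a k).card ≤ (box a u).card :=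
            Finset.card_le_card fun k hk => mem_box_comm.mp (Finset.mem_filter.mp hk).2
          rw [card_box] at this
          exact_mod_cast this
      _ = _ := by rw [Finset.mul_sum]
  rw [hint]
  refine (Finset.abs_sum_le_sum_abs _ _).trans ((Finset.sum_le_sum hstep).trans ?_)
  rw [← Finset.mul_sum, Finset.sum_add_distrib, Finset.sum_add_distrib, Finset.sum_add_distrib,
    ← Finset.mul_sum, ← Finset.mul_sum, ← Finset.mul_sum, ← Finset.mul_sum]
  refine mul_le_mul_of_nonneg_left ?_ hc₂
  linarith

end Comparison

end SpectralUniversality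

namespace SpectralUniversality

/-! ### Passing to the limit. -/

section Limit

variable {Ω : Type*} [m0 : MeasurableSpace Ω] {μ : Measure Ω} [IsProbabilityMeasure μ]
  {X Y : ℤ × ℤ → Ω → ℝ}

theorem tendsto_integral_sub_of_taylorBounds {f : ℕ → (ℤ × ℤ → ℝ) → ℝ}
    {d₁ d₂ : ℕ → ℤ × ℤ → (ℤ × ℤ → ℝ) → ℝ} {c₀ c₁ : ℕ → ℝ} {K : ℝ} (hK : 0 ≤ K)
    (hf : ∀ n : ℕ, 1 ≤ n → TaylorBounds (f n) (d₁ n) (d₂ n) (c₀ n) (c₁ n) (K / (n : ℝ) ^ 2)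
      (K / (n : ℝ) ^ 2 / Real.sqrt n))
    (hfc : ∀ (n : ℕ) (x x' : ℤ × ℤ → ℝ), (∀ p ∈ lowerTriangle n, x p = x' p) → f n x = f n x')
    (hX : ∀ p, Measurable (X p)) (hY : ∀ p, Measurable (Y p)) (hX2 : ∀ p, MemLp (X p) 2 μ)
    (hXY : IndepFun (fun ω p => X p ω) (fun ω p => Y p ω) μ)
    (hmart : ∀ i j : ℤ, 1 ≤ j → j ≤ i → μ[X (i, j) | past X 1 (i, j)] =ᵐ[μ] 0)
    (hYi : ∀ n : ℕ, ∀ k ∈ lowerTriangle n, ∀ V ⊆ lowerTriangle n, k ∉ V →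
      Indep (MeasurableSpace.comap (Y k) inferInstance)
        (⨆ p ∈ V, MeasurableSpace.comap (Y p) inferInstance) μ)
    (hYg : ∀ n : ℕ, ∀ k ∈ lowerTriangle n,
      μ.map (Y k) = gaussianReal 0 (sigmaSq μ X k).toNNReal)
    (h_bound : BddAbove (Set.range fun n : ℕ => (1 / (n : ℝ) ^ 2) *
      ∑ p ∈ lowerTriangle n, sigmaSq μ X p))
    (h_mix : Tendsto (fun a : ℕ => limsup (fun n : ℕ =>
        (∑ p ∈ lowerTriangle n,
          eLpNorm (μ[fun ω => X p ω ^ 2 - sigmaSq μ X p | past X a p]) 1 μ) /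
            (n : ℝ≥0∞) ^ 2) atTop)
      atTop (𝓝 0))
    (h_lindeberg : ∀ ε : ℝ, 0 < ε → Tendsto (fun n : ℕ => (1 / (n : ℝ) ^ 2) *
        ∑ p ∈ lowerTriangle n,
          ∫ ω in {ω | ε * Real.sqrt n < |X p ω|}, X p ω ^ 2 ∂μ) atTop (𝓝 0)) :
    Tendsto (fun n => ∫ ω, f n (fun p => X p ω) ∂μ - ∫ ω, f n (fun p => Y p ω) ∂μ) atTop
      (𝓝 0) := by
  obtain ⟨M, hM⟩ := h_bound
  have hM' : ∀ n : ℕ, (1 / (n : ℝ) ^ 2) * ∑ p ∈ lowerTriangle n, sigmaSq μ X p ≤ M :=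
    fun n => hM ⟨n, rfl⟩
  -- The term `n = 0` of the bounded family is zero.
  have hM0 : 0 ≤ M := by simpa using hM' 0
  rw [Metric.tendsto_atTop']
  intro δ hδ
  -- Three error terms share `δ`; `K + 1` keeps the denominator positive and the final inequality
  -- strict.
  set δ' := δ / (3 * (K + 1)) with hδ'
  have hδ'0 : 0 < δ' := by positivity
  -- The order of choices matters: `a` from mixing, then `ε` depending on the box size for `a`, and
  -- finally `n`.
  obtain ⟨a, ha⟩ := ((h_mix.eventually (gt_mem_nhds (ENNReal.ofReal_pos.mpr hδ'0)))).exists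
  have hA := eventually_lt_of_limsup_lt ha
  set q : ℝ := (2 * a + 1) ^ 2 with hq
  have hq0 : 0 ≤ q := by positivity
  have hC := gaussianThirdMoment_nonneg
  set ε := δ' / ((1 + 2 * gaussianThirdMoment + q) * (M + 1)) with hε
  have hε0 : 0 < ε := by positivity
  have hεM : ε * (1 + 2 * gaussianThirdMoment + q) * M ≤ δ' := by
    have : ε * ((1 + 2 * gaussianThirdMoment + q) * (M + 1)) = δ' :=
      div_mul_cancel₀ _ (by positivity)
    calc _ = ε * ((1 + 2 * gaussianThirdMoment + q) * M) := by ring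
      _ ≤ ε * ((1 + 2 * gaussianThirdMoment + q) * (M + 1)) := by gcongr; linarith
      _ = δ' := this
  have hL := (h_lindeberg ε hε0).const_mul (6 + 4 * q)
  rw [mul_zero] at hL
  have hL' := hL.eventually (gt_mem_nhds hδ'0)
  have hev := (hA.and hL').and (eventually_ge_atTop 1)
  rw [eventually_atTop] at hev
  obtain ⟨n₀, hn₀⟩ := hev
  refine ⟨n₀, fun n hn => ?_⟩
  obtain ⟨⟨hAn, hLn⟩, hn1⟩ := hn₀ n hn.le
  have hn0 : (0 : ℝ) < n := by exact_mod_cast hn1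
  have hsq : 0 < Real.sqrt n := Real.sqrt_pos.mpr hn0
  -- The truncation level `ε * √n` is the one for which `c₃ * b = c₂ * ε`.
  have hcmp := lindeberg_comparison (μ := μ) (hf n hn1) (hfc n) hX hY hX2 hXY hmart (hYi n) (hYg n)
    hε0.le (b := ε * Real.sqrt n) (by positivity) (by positivity)
    (le_of_eq (by field_simp)) a
  rw [dist_zero_right, Real.norm_eq_abs]
  set S₁ := ∑ k ∈ lowerTriangle n,
    ∫ ω, |(μ[fun ω => X k ω ^ 2 - sigmaSq μ X k | past X a k]) ω| ∂μ with hS₁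
  set S₂ := ∑ k ∈ lowerTriangle n, sigmaSq μ X k with hS₂
  set S₃ := ∑ k ∈ lowerTriangle n, tailMoment μ (X k) (ε * Real.sqrt n) with hS₃
  have h1 : 1 / (n : ℝ) ^ 2 * S₁ < δ' := by
    have e : (∑ p ∈ lowerTriangle n,
        eLpNorm (μ[fun ω => X p ω ^ 2 - sigmaSq μ X p | past X a p]) 1 μ) / (n : ℝ≥0∞) ^ 2 =
        ENNReal.ofReal (1 / (n : ℝ) ^ 2 * S₁) := by
      have e1 : ∀ p, eLpNorm (μ[fun ω => X p ω ^ 2 - sigmaSq μ X p | past X a p]) 1 μ =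
          ENNReal.ofReal (∫ ω, |(μ[fun ω => X p ω ^ 2 - sigmaSq μ X p | past X a p]) ω| ∂μ) := by
        intro p
        rw [eLpNorm_one_eq_lintegral_enorm, ← ofReal_integral_norm_eq_lintegral_enorm
          integrable_condExp]
        rfl
      rw [Finset.sum_congr rfl fun p _ => e1 p, ← ENNReal.ofReal_sum_of_nonneg
        fun p _ => integral_nonneg fun _ => abs_nonneg _, one_div_mul_eq_div,
        ENNReal.ofReal_div_of_pos (by positivity), ENNReal.ofReal_pow hn0.le,
        ENNReal.ofReal_natCast]
    rw [e] at hAn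
    exact (ENNReal.ofReal_lt_ofReal_iff hδ'0).mp hAn
  have h2 := hM' n
  have hS1 : 0 ≤ 1 / (n : ℝ) ^ 2 * S₁ := mul_nonneg (by positivity)
    (Finset.sum_nonneg fun p _ => integral_nonneg fun _ => abs_nonneg _)
  calc _ ≤ K / (n : ℝ) ^ 2 * (1 / 2 * S₁ + ε * (1 + 2 * gaussianThirdMoment + q) * S₂ +
        (6 + 4 * q) * S₃) := hcmp
    _ = K * (1 / 2 * (1 / (n : ℝ) ^ 2 * S₁) +
        ε * (1 + 2 * gaussianThirdMoment + q) * (1 / (n : ℝ) ^ 2 * S₂) +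
        (6 + 4 * q) * (1 / (n : ℝ) ^ 2 * S₃)) := by ring
    _ ≤ K * (δ' + δ' + δ') := by
        refine mul_le_mul_of_nonneg_left (add_le_add (add_le_add (by linarith) ?_) hLn.le) hK
        exact (mul_le_mul_of_nonneg_left h2 (by positivity)).trans hεM
    _ < (K + 1) * (δ' + δ' + δ') := by nlinarith
    _ = δ := by rw [hδ']; field_simp; ring

end Limit

/-! ### The squared deviation of the integrated Stieltjes transform. -/

section TestFunction

/-- The integral of `imStieltjes` over a segment parallel to the real axis. -/
noncomputable def integratedStieltjes (n : ℕ) (η a b : ℝ) (x : ℤ × ℤ → ℝ) : ℝ :=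
  ∫ e in a..b, imStieltjes n ⟨e, η⟩ x

theorem arrayMatrix_congr {n : ℕ} {x x' : ℤ × ℤ → ℝ}
    (h : ∀ p ∈ lowerTriangle n, x p = x' p) : arrayMatrix n x = arrayMatrix n x' := by
  ext i j
  rw [arrayMatrix_apply, arrayMatrix_apply]
  congr 1
  split_ifs with hij
  · have : (j : ℕ) ≤ (i : ℕ) := hij
    exact h _ (mem_lowerTriangle.mpr ⟨by simp, by simpa using this, by
      have := i.2; simp only; omega⟩)
  · have : (i : ℕ) < (j : ℕ) := not_le.mp hij
    exact h _ (mem_lowerTriangle.mpr ⟨by simp, by simpa using this.le, by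
      have := j.2; simp only; omega⟩)

theorem integratedStieltjes_congr {n : ℕ} (η a b : ℝ) {x x' : ℤ × ℤ → ℝ}
    (h : ∀ p ∈ lowerTriangle n, x p = x' p) :
    integratedStieltjes n η a b x = integratedStieltjes n η a b x' := by
  simp only [integratedStieltjes, imStieltjes, arrayMatrix_congr h]

/-- Squaring adds `c₁ ^ 2` of order `n⁻³` to the second-order constant and `c₁ * c₂` of order
`n^(-7/2)` to the third-order one, both below the leading `n⁻²` and `n^(-5/2)`. A single `K` is the
sum of the three constants needed. -/
theorem exists_taylorBounds_sq_integratedStieltjes {η : ℝ} (hη : 0 < η) (a b κ : ℝ) :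
    ∃ (d₁ d₂ : ℕ → ℤ × ℤ → (ℤ × ℤ → ℝ) → ℝ) (c₀ c₁ : ℕ → ℝ) (K : ℝ), 0 ≤ K ∧
      (∀ n x, |integratedStieltjes n η a b x - κ| ≤ K) ∧
      (∀ n, Continuous (integratedStieltjes n η a b)) ∧
      ∀ n : ℕ, 1 ≤ n → TaylorBounds (fun x => (integratedStieltjes n η a b x - κ) ^ 2)
        (d₁ n) (d₂ n) (c₀ n) (c₁ n) (K / (n : ℝ) ^ 2) (K / (n : ℝ) ^ 2 / Real.sqrt n) := by
  have hz : ∀ e : ℝ, (⟨e, η⟩ : ℂ).im ≠ 0 := fun e => hη.ne'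
  have hzc : Continuous fun p : (ℤ × ℤ → ℝ) × ℝ => (⟨p.2, η⟩ : ℂ) := by
    have : (fun p : (ℤ × ℤ → ℝ) × ℝ => (⟨p.2, η⟩ : ℂ)) =
        fun p => (p.2 : ℂ) + (η : ℂ) * Complex.I := by
      ext p; exact Complex.mk_eq_add_mul_I _ _
    rw [this]; fun_prop
  set β := η⁻¹ with hβ
  have hβ0 : 0 < β := inv_pos.mpr hη
  set L := |b - a| with hL
  have hL0 : 0 ≤ L := abs_nonneg _
  have h := fun n : ℕ => (TaylorBounds.intervalIntegral
    (fun e => taylorBounds_imStieltjes n (hz e) (β := β) (by simp [hβ, abs_of_pos hη]) rfl)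
    (continuous_imStieltjes n continuous_fst hzc fun p => hz p.2)
    (fun k => continuous_imStieltjesD₁ n k continuous_fst hzc fun p => hz p.2)
    (fun k => continuous_imStieltjesD₂ n k continuous_fst hzc fun p => hz p.2) a b)
  set k₀ := β * L + |κ| with hk₀
  have hk₀' : 0 ≤ k₀ := by positivity
  refine ⟨_, _, _, _, k₀ + (2 * (k₀ * (8 * β ^ 3 * L) + 4 * β ^ 4 * L ^ 2)
    + 2 * (k₀ * (48 * β ^ 4 * L) + 3 * (2 * β ^ 2 * L * (8 * β ^ 3 * L)))), by positivity,
    fun n x => (((h n).sub_const κ).bound x).trans (le_add_of_nonneg_right (by positivity)),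
    fun n => (h n).cont, fun n hn => (((h n).sub_const κ).sq).mono le_rfl le_rfl ?_ ?_⟩
  all_goals
    have hn1 : (1 : ℝ) ≤ n := by exact_mod_cast hn
    have hn0 : (0 : ℝ) < n := by linarith
    obtain ⟨r, hr, hr1⟩ : ∃ r : ℝ, r = (Real.sqrt n)⁻¹ ∧ r ≤ 1 :=
      ⟨_, rfl, inv_le_one_of_one_le₀ (Real.one_le_sqrt.mpr hn1)⟩
    have hr0 : 0 ≤ r := by rw [hr]; positivity
    have hrn : 1 / (n : ℝ) = r ^ 2 := by rw [hr, inv_pow, Real.sq_sqrt hn0.le, one_div]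
    have hγ : 2 / Real.sqrt n = 2 * r := by rw [hr]; ring
    have hn2 : ∀ A : ℝ, A / (n : ℝ) ^ 2 = A * r ^ 4 := fun A => by
      rw [div_eq_mul_one_div, ← one_div_pow, hrn]; ring
    rw [hn2, hγ, hrn, ← hL, ← hk₀]
  · have e1 : 2 * (k₀ * (2 * (r ^ 2 * ((2 * r) ^ 2 * β ^ 3)) * L) +
        (r ^ 2 * (2 * r * β ^ 2) * L) ^ 2) =
        (2 * (k₀ * (8 * β ^ 3 * L) + 4 * β ^ 4 * L ^ 2 * r ^ 2)) * r ^ 4 := by ring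
    rw [e1]
    refine mul_le_mul_of_nonneg_right ?_ (by positivity)
    have e2 : 4 * β ^ 4 * L ^ 2 * r ^ 2 ≤ 4 * β ^ 4 * L ^ 2 :=
      mul_le_of_le_one_right (by positivity) (pow_le_one₀ hr0 hr1)
    have e3 : 0 ≤ 2 * (k₀ * (48 * β ^ 4 * L) + 3 * (2 * β ^ 2 * L * (8 * β ^ 3 * L))) := by
      positivity
    linarith
  · rw [div_eq_mul_inv _ (Real.sqrt n), ← hr]
    have e1 : 2 * (k₀ * (6 * (r ^ 2 * ((2 * r) ^ 3 * β ^ 4)) * L) +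
        3 * (r ^ 2 * (2 * r * β ^ 2) * L * (2 * (r ^ 2 * ((2 * r) ^ 2 * β ^ 3)) * L))) =
        (2 * (k₀ * (48 * β ^ 4 * L) + 3 * (2 * β ^ 2 * L * (8 * β ^ 3 * L)) * r ^ 2)) *
          r ^ 4 * r := by ring
    rw [e1]
    refine mul_le_mul_of_nonneg_right (mul_le_mul_of_nonneg_right ?_ (by positivity)) hr0
    have e2 : 3 * (2 * β ^ 2 * L * (8 * β ^ 3 * L)) * r ^ 2 ≤
        3 * (2 * β ^ 2 * L * (8 * β ^ 3 * L)) :=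
      mul_le_of_le_one_right (by positivity) (pow_le_one₀ hr0 hr1)
    have e3 : 0 ≤ 2 * (k₀ * (8 * β ^ 3 * L) + 4 * β ^ 4 * L ^ 2) := by positivity
    linarith

end TestFunction

end SpectralUniversality

namespace SpectralUniversality

/-! ### Cauchy smoothing and the Lévy distance. -/

section Smoothing

/-- The convolution of a distribution function with a multiple of a Cauchy density. -/
noncomputable def cauchySmooth (η : ℝ) (G : ℝ → ℝ) (t : ℝ) : ℝ :=
  ∫ u, (1 + u ^ 2)⁻¹ * G (t + η * u)

variable {G F : ℝ → ℝ} {η : ℝ}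

theorem integrable_cauchySmooth (hG : Monotone G)
    (h01 : ∀ x, G x ∈ Set.Icc 0 1) (t : ℝ) :
    Integrable fun u : ℝ => (1 + u ^ 2)⁻¹ * G (t + η * u) := by
  refine integrable_inv_one_add_sq.mul_bdd (c := 1) ?_ (Eventually.of_forall fun u => ?_)
  · exact (hG.measurable.comp (by fun_prop)).aestronglyMeasurable
  · rw [Real.norm_eq_abs, abs_of_nonneg (h01 _).1]
    exact (h01 _).2

theorem cauchySmooth_nonneg (h01 : ∀ x, G x ∈ Set.Icc 0 1) (t : ℝ) : 0 ≤ cauchySmooth η G t :=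
  integral_nonneg fun u => mul_nonneg (by positivity) (h01 _).1

theorem cauchySmooth_le_pi (hG : Monotone G) (h01 : ∀ x, G x ∈ Set.Icc 0 1) (t : ℝ) :
    cauchySmooth η G t ≤ Real.pi := by
  rw [← integral_univ_inv_one_add_sq]
  exact integral_mono (integrable_cauchySmooth hG h01 t) integrable_inv_one_add_sq
    fun u => mul_le_of_le_one_right (by positivity) (h01 _).2

/-- For `u ≤ R` monotonicity replaces `G` by its value at `t + η * R`; beyond `R` the bound `G ≤ 1`
leaves the mass of the kernel tail. The kernel has total mass `π`. -/
theorem cauchySmooth_le (hη : 0 < η) (hG : Monotone G) (h01 : ∀ x, G x ∈ Set.Icc 0 1) (t R : ℝ) :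
    cauchySmooth η G t ≤ Real.pi * G (t + η * R) + (Real.pi / 2 - Real.arctan R) := by
  rw [← integral_Ioi_inv_one_add_sq, ← integral_univ_inv_one_add_sq, ← integral_mul_const,
    ← integral_indicator measurableSet_Ioi, ← integral_add]
  · refine integral_mono (integrable_cauchySmooth hG h01 t)
      ((integrable_inv_one_add_sq.mul_const _).add
        (integrable_inv_one_add_sq.indicator measurableSet_Ioi)) fun u => ?_
    have hu : (0 : ℝ) ≤ (1 + u ^ 2)⁻¹ := by positivity
    by_cases h : u ∈ Set.Ioi R
    · simp only [Set.indicator_of_mem h]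
      nlinarith [(h01 (t + η * u)).2, (h01 (t + η * R)).1]
    · simp only [Set.indicator_of_notMem h, add_zero]
      refine mul_le_mul_of_nonneg_left (hG ?_) hu
      have := not_lt.mp (Set.mem_Ioi.not.mp h)
      gcongr
  · exact integrable_inv_one_add_sq.mul_const _
  · exact integrable_inv_one_add_sq.indicator measurableSet_Ioi

theorem le_cauchySmooth (hη : 0 < η) (hG : Monotone G) (h01 : ∀ x, G x ∈ Set.Icc 0 1) (t R : ℝ) :
    Real.pi * G (t - η * R) - (Real.pi / 2 - Real.arctan R) ≤ cauchySmooth η G t := by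
  have e : Real.pi / 2 - Real.arctan R = Real.arctan (-R) + Real.pi / 2 := by
    rw [Real.arctan_neg]; ring
  rw [e, ← integral_Iic_inv_one_add_sq, ← integral_univ_inv_one_add_sq, ← integral_mul_const,
    ← integral_indicator measurableSet_Iic, ← integral_sub]
  · refine integral_mono ((integrable_inv_one_add_sq.mul_const _).sub
        (integrable_inv_one_add_sq.indicator measurableSet_Iic))
        (integrable_cauchySmooth hG h01 t) fun u => ?_
    have hu : (0 : ℝ) ≤ (1 + u ^ 2)⁻¹ := by positivity
    by_cases h : u ∈ Set.Iic (-R)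
    · simp only [Set.indicator_of_mem h]
      nlinarith [(h01 (t + η * u)).1, (h01 (t - η * R)).2]
    · simp only [Set.indicator_of_notMem h, sub_zero]
      refine mul_le_mul_of_nonneg_left (hG ?_) hu
      have := not_le.mp (Set.mem_Iic.not.mp h)
      nlinarith
  · exact integrable_inv_one_add_sq.mul_const _
  · exact integrable_inv_one_add_sq.indicator measurableSet_Iic

theorem IsDistributionFunction.mem_Icc (hF : IsDistributionFunction F) (x : ℝ) :
    F x ∈ Set.Icc 0 1 :=
  ⟨hF.mono.le_of_tendsto hF.tendsto_atBot x, hF.mono.ge_of_tendsto hF.tendsto_atTop x⟩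

/-- The infimum need not be attained, so an admissible `ε' < ε` is used. Translating `x` by `± ε'`
exchanges the roles of the two functions. -/
theorem exists_of_levyDist_lt (hF : IsDistributionFunction F) (hG : ∀ x, G x ∈ Set.Icc 0 1)
    {ε : ℝ} (h : levyDist G F < ε) (x : ℝ) :
    F (x - ε) - ε ≤ G x ∧ G x ≤ F (x + ε) + ε := by
  have hne : {ε : ℝ | 0 < ε ∧ ∀ x : ℝ, G (x - ε) - ε ≤ F x ∧ F x ≤ G (x + ε) + ε}.Nonempty := by
    refine ⟨1, one_pos, fun x => ?_⟩
    have h1 := hF.mem_Icc x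
    have h2 := hG (x - 1)
    have h3 := hG (x + 1)
    constructor <;> linarith [h1.1, h1.2, h2.1, h2.2, h3.1, h3.2]
  obtain ⟨ε', ⟨-, hx⟩, hε'⟩ := exists_lt_of_csInf_lt hne h
  have h1 := (hx (x + ε')).1
  have h2 := (hx (x - ε')).2
  rw [add_sub_cancel_right] at h1
  rw [sub_add_cancel] at h2
  have h3 := hF.mono (by linarith : x + ε' ≤ x + ε)
  have h4 := hF.mono (by linarith : x - ε ≤ x - ε')
  constructor <;> linarith

/-- A sequence of counterexamples would converge to `F` at its continuity points. These are all but
countably many, so dominated convergence gives a contradiction. -/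
theorem exists_abs_cauchySmooth_sub_lt (hF : IsDistributionFunction F) (hη : 0 < η) (t : ℝ)
    {δ : ℝ} (hδ : 0 < δ) :
    ∃ ε > 0, ∀ G : ℝ → ℝ, Monotone G → (∀ x, G x ∈ Set.Icc 0 1) → levyDist G F < ε →
      |cauchySmooth η G t - cauchySmooth η F t| < δ := by
  by_contra! hcon
  choose G hGm hG hGl hGd using fun m : ℕ =>
    hcon (1 / ((m : ℝ) + 1)) (by positivity)
  have hlim0 : Tendsto (fun m : ℕ => 1 / ((m : ℝ) + 1)) atTop (𝓝 0) :=
    tendsto_one_div_add_atTop_nhds_zero_nat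
  have hpt : ∀ x, ContinuousAt F x → Tendsto (fun m => G m x) atTop (𝓝 (F x)) := by
    intro x hx
    have h1 : Tendsto (fun m : ℕ => F (x - 1 / ((m : ℝ) + 1)) - 1 / ((m : ℝ) + 1)) atTop
        (𝓝 (F x)) := by
      have : Tendsto (fun m : ℕ => x - 1 / ((m : ℝ) + 1)) atTop (𝓝 x) := by
        simpa using tendsto_const_nhds.sub hlim0
      simpa using (hx.tendsto.comp this).sub hlim0
    have h2 : Tendsto (fun m : ℕ => F (x + 1 / ((m : ℝ) + 1)) + 1 / ((m : ℝ) + 1)) atTop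
        (𝓝 (F x)) := by
      have : Tendsto (fun m : ℕ => x + 1 / ((m : ℝ) + 1)) atTop (𝓝 x) := by
        simpa using tendsto_const_nhds.add hlim0
      simpa using (hx.tendsto.comp this).add hlim0
    exact tendsto_of_tendsto_of_tendsto_of_le_of_le h1 h2
      (fun m => (exists_of_levyDist_lt hF (hG m) (hGl m) x).1)
      (fun m => (exists_of_levyDist_lt hF (hG m) (hGl m) x).2)
  have hae : ∀ᵐ u : ℝ, ContinuousAt F (t + η * u) := by
    have hc : {u : ℝ | ¬ ContinuousAt F (t + η * u)}.Countable :=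
      hF.mono.countable_not_continuousAt.preimage (f := fun u => t + η * u)
        fun u v h => by simpa [hη.ne'] using h
    exact hc.measure_zero volume
  have hconv : Tendsto (fun m => cauchySmooth η (G m) t) atTop (𝓝 (cauchySmooth η F t)) := by
    refine tendsto_integral_of_dominated_convergence (fun u => (1 + u ^ 2)⁻¹)
      (fun m => (integrable_cauchySmooth (hGm m) (hG m) t).aestronglyMeasurable)
      integrable_inv_one_add_sq (fun m => Eventually.of_forall fun u => ?_) ?_
    · have hu : (0 : ℝ) ≤ (1 + u ^ 2)⁻¹ := by positivity
      rw [Real.norm_eq_abs, abs_of_nonneg (mul_nonneg hu (hG m _).1)]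
      exact mul_le_of_le_one_right hu (hG m _).2
    · filter_upwards [hae] with u hu
      exact (hpt _ hu).const_mul _
  obtain ⟨m, hm⟩ := (Metric.tendsto_atTop.mp hconv δ hδ)
  have := hm m le_rfl
  rw [Real.dist_eq] at this
  exact absurd this (not_lt.mpr (hGd m))

/-- Smoothing by a narrow kernel moves arguments by at most `r`, up to a small mass, and
monotonicity fills in between the points of a finite grid. Only increments from the base point are
assumed close, since the resolvent gives nothing more. The absolute level is recovered because the
increment over the whole grid is nearly the full mass `π`, which forces the smoothed `G` to be small
at the left end. -/
theorem exists_levyDist_le (hF : IsDistributionFunction F) {δ : ℝ} (hδ : 0 < δ) :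
    ∃ η > 0, ∃ (T : Finset ℝ) (t₀ γ : ℝ), 0 < γ ∧
      ∀ G : ℝ → ℝ, Monotone G → (∀ x, G x ∈ Set.Icc 0 1) →
        (∀ t ∈ T, |(cauchySmooth η G t - cauchySmooth η G t₀) -
          (cauchySmooth η F t - cauchySmooth η F t₀)| ≤ γ) → levyDist G F ≤ δ := by
  -- Three shifts add up to `δ`: smoothing of `G`, smoothing of `F`, and rounding to the grid.
  set r := δ / 3 with hr
  have hr0 : 0 < r := by positivity
  set τ := δ / 10 with hτ
  have hτ0 : 0 < τ := by positivity
  have hπ := Real.pi_gt_three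
  obtain ⟨R, hR, hR0⟩ : ∃ R : ℝ, Real.pi / 2 - Real.arctan R < τ ∧ 0 < R := by
    have h1 : Tendsto (fun R => Real.pi / 2 - Real.arctan R) atTop (𝓝 0) := by
      have := (tendsto_nhds_of_tendsto_nhdsWithin Real.tendsto_arctan_atTop).const_sub
        (Real.pi / 2)
      simpa using this
    exact ((h1.eventually (gt_mem_nhds hτ0)).and (eventually_gt_atTop 0)).exists
  have hβ0 : 0 ≤ Real.pi / 2 - Real.arctan R := by linarith [Real.arctan_lt_pi_div_two R]
  set β := Real.pi / 2 - Real.arctan R with hβ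
  have hηR : r / R * R = r := div_mul_cancel₀ _ hR0.ne'
  have hη0 : 0 < r / R := by positivity
  set η := r / R with hη
  obtain ⟨N, hN1, hN2⟩ : ∃ N : ℕ, Real.pi * F (-(N * r) + r) < τ ∧
      Real.pi * (1 - F (N * r - r)) < τ := by
    have hN : Tendsto (fun N : ℕ => (N : ℝ) * r) atTop atTop :=
      tendsto_natCast_atTop_atTop.atTop_mul_const hr0
    have h1 : Tendsto (fun N : ℕ => Real.pi * F (-((N : ℝ) * r) + r)) atTop (𝓝 0) := by
      have := (hF.tendsto_atBot.comp (tendsto_atBot_add_const_right _ r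
        (tendsto_neg_atTop_atBot.comp hN))).const_mul Real.pi
      simpa using this
    have h2 : Tendsto (fun N : ℕ => Real.pi * (1 - F ((N : ℝ) * r - r))) atTop (𝓝 0) := by
      have := ((hF.tendsto_atTop.comp (tendsto_atTop_add_const_right _ (-r) hN)).const_sub
        1).const_mul Real.pi
      simpa [sub_eq_add_neg] using this
    exact ((h1.eventually (gt_mem_nhds hτ0)).and (h2.eventually (gt_mem_nhds hτ0))).exists
  set M := (N : ℝ) * r with hM
  refine ⟨η, hη0, (Finset.range (2 * N + 1)).image fun j : ℕ => -M + j * r, -M, τ, hτ0,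
    fun G hGm hG hclose => ?_⟩
  have hF01 := hF.mem_Icc
  have grid : ∀ y, -M ≤ y → y + r ≤ M →
      ∃ t ∈ (Finset.range (2 * N + 1)).image (fun j : ℕ => -M + j * r), y ≤ t ∧ t ≤ y + r := by
    intro y hy1 hy2
    have h0 : 0 ≤ (y + M) / r := div_nonneg (by linarith) hr0.le
    have h1 := Nat.le_ceil ((y + M) / r)
    have h2 := Nat.ceil_lt_add_one h0
    rw [div_le_iff₀ hr0] at h1
    rw [← sub_lt_iff_lt_add, lt_div_iff₀ hr0] at h2
    refine ⟨-M + (⌈(y + M) / r⌉₊ : ℕ) * r, Finset.mem_image.mpr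
      ⟨_, Finset.mem_range.mpr ?_, rfl⟩, ?_, ?_⟩
    · have : ((⌈(y + M) / r⌉₊ : ℕ) : ℝ) * r < ((2 * N + 1 : ℕ) : ℝ) * r := by
        push_cast
        linarith
      exact_mod_cast lt_of_mul_lt_mul_right this hr0.le
    · linarith
    · linarith
  have hMmem : M ∈ (Finset.range (2 * N + 1)).image (fun j : ℕ => -M + j * r) :=
    Finset.mem_image.mpr ⟨2 * N, Finset.mem_range.mpr (Nat.lt_succ_self _), by
      push_cast; rw [hM]; ring⟩
  have upper : ∀ {H : ℝ → ℝ}, Monotone H → (∀ x, H x ∈ Set.Icc 0 1) → ∀ t,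
      cauchySmooth η H t ≤ Real.pi * H (t + r) + β := fun hm h01 t => by
    simpa only [hηR] using cauchySmooth_le hη0 hm h01 t R
  have lower : ∀ {H : ℝ → ℝ}, Monotone H → (∀ x, H x ∈ Set.Icc 0 1) → ∀ t,
      Real.pi * H (t - r) - β ≤ cauchySmooth η H t := fun hm h01 t => by
    simpa only [hηR] using le_cauchySmooth hη0 hm h01 t R
  have hFM := upper hF.mono hF01 (-M)
  have hFM' := lower hF.mono hF01 M
  have hGM' := cauchySmooth_le_pi (η := η) hGm hG M
  have hGM0 := cauchySmooth_nonneg (η := η) hG (-M)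
  have hFM0 := cauchySmooth_nonneg (η := η) hF01 (-M)
  have hcM := abs_le.mp (hclose M hMmem)
  -- The increment of the smoothed `F` over the grid exceeds `π - 4 * τ`, hence that of `G` is at
  -- least `π - 5 * τ`, while its value at `M` is at most `π`.
  have hGM : cauchySmooth η G (-M) ≤ 5 * τ := by linarith [hcM.1]
  have hnear : ∀ t ∈ (Finset.range (2 * N + 1)).image (fun j : ℕ => -M + j * r),
      |cauchySmooth η G t - cauchySmooth η F t| ≤ 6 * τ := by
    intro t ht
    have := abs_le.mp (hclose t ht)
    rw [abs_le]
    constructor <;> linarith [this.1, this.2]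
  -- Total errors reach at most `8 * τ = 4 * δ / 5`, less than `π * δ`.
  have hdiv : ∀ {p q c : ℝ}, c ≤ 8 * τ → Real.pi * p ≤ Real.pi * q + c → p ≤ q + δ := by
    intro p q c hc h
    by_contra! hlt
    nlinarith
  have hm : ∀ {p q : ℝ}, p ≤ q → Real.pi * p ≤ Real.pi * q := fun h =>
    mul_le_mul_of_nonneg_left h (by linarith)
  refine csInf_le ⟨0, fun ε hε => hε.1.le⟩ ⟨hδ, fun x => ⟨?_, ?_⟩⟩
  · have : G (x - δ) ≤ F x + δ := by
      have hx := hF01 x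
      by_cases h1 : M < x - r
      · have : F (M - r) ≤ F x := hF.mono (by linarith)
        refine hdiv (c := τ) (by linarith) ?_
        linarith [hm (hG (x - δ)).2, hm this]
      by_cases h2 : x - 2 * r < -M
      · have h3 := lower hGm hG (-M)
        have : G (x - δ) ≤ G (-M - r) := hGm (by linarith)
        refine hdiv (c := 6 * τ) (by linarith) ?_
        linarith [hm hx.1, hm this]
      obtain ⟨t, ht, ht1, ht2⟩ := grid (x - 2 * r) (by linarith) (by linarith)
      have h3 := lower hGm hG t
      have h4 := upper hF.mono hF01 t
      have h5 := abs_le.mp (hnear t ht)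
      have h6 : G (x - δ) ≤ G (t - r) := hGm (by linarith)
      have h7 : F (t + r) ≤ F x := hF.mono (by linarith)
      refine hdiv (c := 8 * τ) le_rfl ?_
      linarith [h5.2, hm h6, hm h7]
    linarith
  · have hx := hG (x + δ)
    by_cases h1 : M < x + 2 * r
    · have h3 := upper hGm hG M
      have h4 : G (M + r) ≤ G (x + δ) := hGm (by linarith)
      refine hdiv (c := 8 * τ) le_rfl ?_
      linarith [hm (hF01 x).2, hm h4, hcM.1]
    by_cases h2 : x + r < -M
    · have : F x ≤ F (-M + r) := hF.mono (by linarith)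
      refine hdiv (c := τ) (by linarith) ?_
      linarith [hm hx.1, hm this]
    obtain ⟨t, ht, ht1, ht2⟩ := grid (x + r) (by linarith) (by linarith)
    have h3 := lower hF.mono hF01 t
    have h4 := upper hGm hG t
    have h5 := abs_le.mp (hnear t ht)
    have h6 : F x ≤ F (t - r) := hF.mono (by linarith)
    have h7 : G (t + r) ≤ G (x + δ) := hGm (by linarith)
    refine hdiv (c := 8 * τ) le_rfl ?_
    linarith [h5.1, hm h6, hm h7]

end Smoothing

end SpectralUniversality

namespace SpectralUniversality

/-! ### Smoothed empirical spectral distributions and resolvents. -/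

section EmpiricalDistribution

theorem esd_monotone (n : ℕ) (x : ℕ+ → ℕ+ → ℝ) : Monotone (esd n x) := by
  intro s t hst
  refine mul_le_mul_of_nonneg_left (Finset.sum_le_sum fun k _ => ?_) (by positivity)
  exact Set.indicator_le_indicator_of_subset (fun u hu => le_trans hu hst)
    (fun _ => zero_le_one) _

theorem esd_mem_Icc (n : ℕ) (x : ℕ+ → ℕ+ → ℝ) (t : ℝ) : esd n x t ∈ Set.Icc 0 1 := by
  refine ⟨mul_nonneg (by positivity) (Finset.sum_nonneg fun k _ =>
    Set.indicator_nonneg (fun _ _ => zero_le_one) _), ?_⟩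
  have h : ∑ k : Fin n, Set.indicator {s : ℝ | s ≤ t} (fun _ => (1 : ℝ))
      ((normMatrix_isHermitian n x).eigenvalues k) ≤ n := by
    refine (Finset.sum_le_card_nsmul _ _ 1 fun k _ =>
      Set.indicator_le_self' (fun _ _ => zero_le_one) _).trans_eq ?_
    simp
  rw [esd, one_div]
  exact (mul_le_mul_of_nonneg_left h (by positivity)).trans inv_mul_le_one

theorem cauchySmooth_indicator {η : ℝ} (hη : 0 < η) (l t : ℝ) :
    cauchySmooth η (fun t => Set.indicator {s : ℝ | s ≤ t} (fun _ => 1) l) t =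
      Real.pi / 2 - Real.arctan ((l - t) / η) := by
  rw [← integral_Ioi_inv_one_add_sq, ← integral_Ici_eq_integral_Ioi,
    ← integral_indicator measurableSet_Ici]
  refine integral_congr_ae (Eventually.of_forall fun u => ?_)
  have h : l ≤ t + η * u ↔ (l - t) / η ≤ u := by
    rw [div_le_iff₀ hη]; constructor <;> intro h <;> linarith
  by_cases hu : (l - t) / η ≤ u
  · simp [hu, h.mpr hu]
  · have hu' := h.not.mpr hu
    simp [hu, hu']

theorem cauchySmooth_esd {η : ℝ} (hη : 0 < η) (n : ℕ) (x : ℕ+ → ℕ+ → ℝ) (t : ℝ) :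
    cauchySmooth η (esd n x) t = (1 / (n : ℝ)) * ∑ k : Fin n, (Real.pi / 2 -
      Real.arctan (((normMatrix_isHermitian n x).eigenvalues k - t) / η)) := by
  have hi : ∀ k : Fin n, Integrable fun u : ℝ => (1 + u ^ 2)⁻¹ *
      Set.indicator {s : ℝ | s ≤ t + η * u} (fun _ => (1 : ℝ))
        ((normMatrix_isHermitian n x).eigenvalues k) := by
    intro k
    refine integrable_cauchySmooth (G := fun t => Set.indicator {s : ℝ | s ≤ t} (fun _ => (1 : ℝ))
      ((normMatrix_isHermitian n x).eigenvalues k)) (fun s t hst => ?_) (fun y => ?_) t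
    · exact Set.indicator_le_indicator_of_subset (fun u hu => le_trans hu hst)
        (fun _ => zero_le_one) _
    · exact ⟨Set.indicator_nonneg (fun _ _ => zero_le_one) _,
        Set.indicator_le_self' (fun _ _ => zero_le_one) _⟩
  rw [← Finset.sum_congr rfl fun k _ => cauchySmooth_indicator hη _ t]
  simp only [cauchySmooth, esd]
  rw [← integral_finsetSum _ fun k _ => hi k, ← integral_const_mul]
  refine integral_congr_ae (Eventually.of_forall fun u => ?_)
  simp only [Finset.mul_sum]
  exact Finset.sum_congr rfl fun k _ => by ring

theorem integral_poisson {η : ℝ} (hη : 0 < η) (l a b : ℝ) :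
    ∫ e in a..b, η / ((l - e) ^ 2 + η ^ 2) =
      Real.arctan ((l - a) / η) - Real.arctan ((l - b) / η) := by
  have hd : ∀ e ∈ Set.uIcc a b, HasDerivAt (fun e => -Real.arctan ((l - e) / η))
      (η / ((l - e) ^ 2 + η ^ 2)) e := by
    intro e _
    have h := ((((hasDerivAt_id e).const_sub l).div_const η).arctan).neg
    refine h.congr_deriv ?_
    simp only [id]
    field_simp
    ring
  rw [intervalIntegral.integral_eq_sub_of_hasDerivAt hd]
  · ring
  · refine Continuous.intervalIntegrable ?_ _ _
    exact continuous_const.div (by fun_prop) fun e => by positivity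

/-- For each eigenvalue both sides are the same difference of arctangents: the Poisson kernel
integrates to it, and the smoothed step function is `π / 2` minus an arctangent. -/
theorem integratedStieltjes_eq {η : ℝ} (hη : 0 < η) (n : ℕ) (a b : ℝ) (x : ℤ × ℤ → ℝ) :
    integratedStieltjes n η a b x =
      cauchySmooth η (esd n fun i j => x ((i : ℤ), (j : ℤ))) b -
        cauchySmooth η (esd n fun i j => x ((i : ℤ), (j : ℤ))) a := by
  rw [cauchySmooth_esd hη, cauchySmooth_esd hη, integratedStieltjes, ← mul_sub,
    ← Finset.sum_sub_distrib]
  simp only [imStieltjes_eq_sum n x _ hη]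
  rw [intervalIntegral.integral_const_mul, intervalIntegral.integral_finsetSum]
  · congr 1
    refine Finset.sum_congr rfl fun k _ => ?_
    rw [integral_poisson hη]
    change _ - _ = (Real.pi / 2 - Real.arctan
      (((arrayMatrix_isHermitian n x).eigenvalues k - b) / η)) - (Real.pi / 2 - Real.arctan
      (((arrayMatrix_isHermitian n x).eigenvalues k - a) / η))
    ring
  · refine fun k _ => Continuous.intervalIntegrable ?_ _ _
    exact continuous_const.div (by fun_prop) fun e => by positivity

end EmpiricalDistribution

/-! ### Convergence in probability and in mean square for bounded variables. -/

section Probability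

variable {Ω : Type*} [MeasurableSpace Ω] {μ : Measure Ω} [IsProbabilityMeasure μ]

theorem tendsto_integral_sq_of_tendsto_measure {v : ℕ → Ω → ℝ} {K : ℝ}
    (hv : ∀ n, Measurable (v n)) (hK : ∀ n ω, |v n ω| ≤ K)
    (h : ∀ ε : ℝ, 0 < ε → Tendsto (fun n => μ {ω | ε < |v n ω|}) atTop (𝓝 0)) :
    Tendsto (fun n => ∫ ω, v n ω ^ 2 ∂μ) atTop (𝓝 0) := by
  rw [Metric.tendsto_atTop']
  intro δ hδ
  set ε := Real.sqrt (δ / 2) with hε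
  have hε0 : 0 < ε := Real.sqrt_pos.mpr (by positivity)
  have hε2 : ε ^ 2 = δ / 2 := Real.sq_sqrt (by positivity)
  have h1 : Tendsto (fun n => K ^ 2 * μ.real {ω | ε < |v n ω|}) atTop (𝓝 0) := by
    have := ((ENNReal.tendsto_toReal ENNReal.zero_ne_top).comp (h ε hε0)).const_mul (K ^ 2)
    simpa [Measure.real] using this
  obtain ⟨n₀, hn₀⟩ := eventually_atTop.mp (h1.eventually (gt_mem_nhds (half_pos hδ)))
  refine ⟨n₀, fun n hn => ?_⟩
  rw [dist_zero_right, Real.norm_of_nonneg (integral_nonneg fun _ => sq_nonneg _)]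
  have hs : MeasurableSet {ω | ε < |v n ω|} := measurableSet_lt measurable_const (hv n).abs
  calc ∫ ω, v n ω ^ 2 ∂μ
      ≤ ∫ ω, (ε ^ 2 + K ^ 2 * Set.indicator {ω | ε < |v n ω|} 1 ω) ∂μ := by
        refine integral_mono_of_nonneg (Eventually.of_forall fun _ => sq_nonneg _)
          ((integrable_const _).add (((integrable_const (1 : ℝ)).indicator hs).const_mul _))
          (Eventually.of_forall fun ω => ?_)
        by_cases hω : ε < |v n ω|
        · have : v n ω ^ 2 ≤ K ^ 2 := sq_le_sq' (abs_le.mp (hK n ω)).1 (abs_le.mp (hK n ω)).2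
          simp only [Set.mem_ofPred_eq, hω, Set.indicator_of_mem, Pi.one_apply, mul_one]
          nlinarith
        · have : v n ω ^ 2 ≤ ε ^ 2 := by
            rw [sq_le_sq, abs_of_pos hε0]
            exact not_lt.mp hω
          simpa [hω] using this
    _ = ε ^ 2 + K ^ 2 * μ.real {ω | ε < |v n ω|} := by
        have hi : Integrable (Set.indicator {ω | ε < |v n ω|} (1 : Ω → ℝ)) μ :=
          (integrable_const (1 : ℝ)).indicator hs
        rw [integral_add (integrable_const _) (hi.const_mul _), integral_const_mul,
          integral_indicator_one hs]
        simp
    _ < δ := by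
        have := hn₀ n hn.le
        rw [hε2]; linarith

theorem tendsto_measure_of_tendsto_integral_sq {v : ℕ → Ω → ℝ} {K : ℝ}
    (hv : ∀ n, Measurable (v n)) (hK : ∀ n ω, |v n ω| ≤ K)
    (h : Tendsto (fun n => ∫ ω, v n ω ^ 2 ∂μ) atTop (𝓝 0)) {ε : ℝ} (hε : 0 < ε) :
    Tendsto (fun n => μ {ω | ε < |v n ω|}) atTop (𝓝 0) := by
  have h1 : ∀ n, μ {ω | ε < |v n ω|} ≤ ENNReal.ofReal ((∫ ω, v n ω ^ 2 ∂μ) / ε ^ 2) := by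
    intro n
    have hi : Integrable (fun ω => v n ω ^ 2) μ :=
      Integrable.of_bound ((hv n).pow_const 2).aestronglyMeasurable (K ^ 2)
        (Eventually.of_forall fun ω => by
          rw [Real.norm_of_nonneg (sq_nonneg _)]
          exact sq_le_sq' (abs_le.mp (hK n ω)).1 (abs_le.mp (hK n ω)).2)
    have h2 := mul_meas_ge_le_integral_of_nonneg (Eventually.of_forall fun ω =>
      sq_nonneg (v n ω)) hi (ε ^ 2)
    have h3 : μ.real {ω | ε < |v n ω|} ≤ μ.real {ω | ε ^ 2 ≤ v n ω ^ 2} := by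
      refine measureReal_mono fun ω hω => ?_
      have hω' : ε < |v n ω| := hω
      change ε ^ 2 ≤ v n ω ^ 2
      rw [sq_le_sq, abs_of_pos hε]
      exact hω'.le
    rw [← ENNReal.ofReal_toReal (measure_ne_top μ {ω | ε < |v n ω|})]
    refine ENNReal.ofReal_le_ofReal ?_
    rw [le_div_iff₀ (by positivity)]
    have h4 := mul_le_mul_of_nonneg_left h3 (sq_nonneg ε)
    calc _ = ε ^ 2 * μ.real {ω | ε < |v n ω|} := mul_comm _ _
      _ ≤ _ := h4.trans h2
  refine tendsto_of_tendsto_of_tendsto_of_le_of_le tendsto_const_nhds ?_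
    (fun n => zero_le) h1
  have := ENNReal.tendsto_ofReal (h.div_const (ε ^ 2))
  simpa using this

end Probability

/-! ### Transfer between positive and integer indices. -/

/-- The pair of positive integers corresponding to a pair of integers with positive entries. -/
def toPNatPair (p : ℤ × ℤ) : ℕ+ × ℕ+ := (p.1.toNat.toPNat', p.2.toNat.toPNat')

theorem toPNatPair_coe (i j : ℕ+) : toPNatPair ((i : ℤ), (j : ℤ)) = (i, j) := by
  simp [toPNatPair]

theorem coe_toPNatPair {p : ℤ × ℤ} (h1 : 1 ≤ p.1) (h2 : 1 ≤ p.2) :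
    (((toPNatPair p).1 : ℤ), ((toPNatPair p).2 : ℤ)) = p := by
  have e : ∀ m : ℤ, 1 ≤ m → ((m.toNat.toPNat' : ℕ+) : ℤ) = m := by
    intro m hm
    have h3 : 0 < m.toNat := by omega
    have : ((m.toNat.toPNat' : ℕ+) : ℕ) = m.toNat := by rw [Nat.toPNat'_coe, if_pos h3]
    omega
  exact Prod.ext (e _ h1) (e _ h2)

/-- `toPNatPair` collapses nonpositive indices, so independence is claimed only inside the triangle,
where the map has `coe_toPNatPair` as a left inverse. -/
theorem indep_comp_toPNatPair {Ω : Type*} [MeasurableSpace Ω] {μ : Measure Ω}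
    {Y : ℕ+ × ℕ+ → Ω → ℝ} (hY : ∀ p, Measurable (Y p)) (h : iIndepFun Y μ) {n : ℕ} {k : ℤ × ℤ}
    (hk : k ∈ lowerTriangle n) {V : Finset (ℤ × ℤ)} (hV : V ⊆ lowerTriangle n) (hkV : k ∉ V) :
    Indep (MeasurableSpace.comap (Y (toPNatPair k)) inferInstance)
      (⨆ p ∈ V, MeasurableSpace.comap (Y (toPNatPair p)) inferInstance) μ := by
  have hi := indep_iSup_of_disjoint (S := {toPNatPair k}) (T := toPNatPair '' (V : Set (ℤ × ℤ)))
    (fun p => (hY p).comap_le) h.iIndep ?_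
  · refine indep_of_indep_of_le_left (indep_of_indep_of_le_right hi ?_) ?_
    · exact iSup₂_le fun p hp => le_iSup₂_of_le (f := fun q
        (_ : q ∈ toPNatPair '' (V : Set (ℤ × ℤ))) => MeasurableSpace.comap (Y q) inferInstance)
        (toPNatPair p) (Set.mem_image_of_mem _ hp) le_rfl
    · exact le_iSup₂_of_le (f := fun q (_ : q ∈ ({toPNatPair k} : Set (ℕ+ × ℕ+))) =>
        MeasurableSpace.comap (Y q) inferInstance) (toPNatPair k) rfl le_rfl
  · rw [Set.disjoint_singleton_left]
    rintro ⟨p, hp, hpk⟩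
    have h1 := mem_lowerTriangle.mp hk
    have h2 := mem_lowerTriangle.mp (hV hp)
    have e1 := coe_toPNatPair (by omega) h1.1
    have e2 := coe_toPNatPair (by omega) h2.1
    rw [hpk, e1] at e2
    exact hkV (e2 ▸ hp)

end SpectralUniversality


/-! ### Conclusion. -/

theorem mainTheorem8 {Ω : Type*} [MeasurableSpace Ω] (μ : Measure Ω) [IsProbabilityMeasure μ]
    (X : ℤ × ℤ → Ω → ℝ) (Y : ℕ+ × ℕ+ → Ω → ℝ)
    (hX_meas : ∀ p, Measurable (X p))
    (hX_sq : ∀ p, MemLp (X p) 2 μ)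
    (hX_mean : ∀ p, ∫ ω, X p ω ∂μ = 0)
    (hY_meas : ∀ p, Measurable (Y p))
    (hY_gauss : ∀ p : ℕ+ × ℕ+, μ.map (Y p) =
      gaussianReal 0 (SpectralUniversality.sigmaSq μ X ((p.1 : ℤ), (p.2 : ℤ))).toNNReal)
    (hY_indep : iIndepFun Y μ)
    (hXY_indep : IndepFun (fun ω p => X p ω) (fun ω p => Y p ω) μ)
    (h_mart : ∀ i j : ℤ, 1 ≤ j → j ≤ i →
      μ[X (i, j) | SpectralUniversality.past X 1 (i, j)] =ᵐ[μ] 0)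
    (h_bound : BddAbove (Set.range fun n : ℕ => (1 / (n : ℝ) ^ 2) *
      ∑ p ∈ SpectralUniversality.lowerTriangle n, SpectralUniversality.sigmaSq μ X p))
    (h_mix : Tendsto (fun a : ℕ => limsup (fun n : ℕ =>
        (∑ p ∈ SpectralUniversality.lowerTriangle n,
          eLpNorm (μ[fun ω => X p ω ^ 2 - SpectralUniversality.sigmaSq μ X p |
            SpectralUniversality.past X a p]) 1 μ) / (n : ℝ≥0∞) ^ 2) atTop)
      atTop (𝓝 0))
    (h_lindeberg : ∀ ε : ℝ, 0 < ε → Tendsto (fun n : ℕ => (1 / (n : ℝ) ^ 2) *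
        ∑ p ∈ SpectralUniversality.lowerTriangle n,
          ∫ ω in {ω | ε * Real.sqrt n < |X p ω|}, X p ω ^ 2 ∂μ) atTop (𝓝 0))
    (F : ℝ → ℝ) (hF : SpectralUniversality.IsDistributionFunction F)
    (hYF : SpectralUniversality.WeakTendstoInProbability μ
      (fun n ω => SpectralUniversality.esd n (fun i j => Y (i, j) ω)) F) :
    SpectralUniversality.WeakTendstoInProbability μ
      (fun n ω => SpectralUniversality.esd n (fun i j => X ((i : ℤ), (j : ℤ)) ω)) F := by

  set Y' : ℤ × ℤ → Ω → ℝ :=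
    fun p => Y (SpectralUniversality.toPNatPair p) with hY'
  have hY'm : ∀ p, Measurable (Y' p) := fun p => hY_meas _
  have hXm : Measurable fun ω p => X p ω := measurable_pi_iff.mpr hX_meas
  have hYm : Measurable fun ω p => Y' p ω := measurable_pi_iff.mpr hY'm
  have hXY : IndepFun (fun ω p => X p ω) (fun ω p => Y' p ω) μ :=
    hXY_indep.comp (φ := fun x : ℤ × ℤ → ℝ => x)
      (ψ := fun (y : ℕ+ × ℕ+ → ℝ) (p : ℤ × ℤ) => y (SpectralUniversality.toPNatPair p)) measurable_id'
      (measurable_pi_iff.mpr fun p => measurable_pi_apply _)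
  have hYg : ∀ n : ℕ, ∀ k ∈ SpectralUniversality.lowerTriangle n,
      μ.map (Y' k) = gaussianReal 0 (SpectralUniversality.sigmaSq μ X k).toNNReal := by
    intro n k hk
    have h1 := SpectralUniversality.mem_lowerTriangle.mp hk
    rw [hY', hY_gauss, SpectralUniversality.coe_toPNatPair (by omega) h1.1]
  have hYesd : ∀ n ω, SpectralUniversality.esd n (fun i j => Y' ((i : ℤ), (j : ℤ)) ω) =
      SpectralUniversality.esd n (fun i j => Y (i, j) ω) := by
    intro n ω
    simp only [hY', SpectralUniversality.toPNatPair_coe]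
  intro δ hδ
  obtain ⟨η, hη, T, t₀, γ, hγ, hT⟩ := SpectralUniversality.exists_levyDist_le hF hδ
  have key : ∀ t, Tendsto (fun n => μ {ω | γ <
      |SpectralUniversality.integratedStieltjes n η t₀ t (fun p => X p ω) -
        (SpectralUniversality.cauchySmooth η F t - SpectralUniversality.cauchySmooth η F t₀)|})
      atTop (𝓝 0) := by
    intro t
    set κ := SpectralUniversality.cauchySmooth η F t - SpectralUniversality.cauchySmooth η F t₀
      with hκ
    obtain ⟨d₁, d₂, c₀, c₁, K, hK, hbd, hcont, htb⟩ :=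
      SpectralUniversality.exists_taylorBounds_sq_integratedStieltjes hη t₀ t κ
    have hmeas : ∀ {Z : Ω → ℤ × ℤ → ℝ}, Measurable Z → ∀ n, Measurable fun ω =>
        SpectralUniversality.integratedStieltjes n η t₀ t (Z ω) - κ :=
      fun hZ n => ((hcont n).measurable.comp hZ).sub_const κ
    have hlim := SpectralUniversality.tendsto_integral_sub_of_taylorBounds hK htb
      (fun n x x' h => by
        simp only [SpectralUniversality.integratedStieltjes_congr η t₀ t h])
      hX_meas hY'm hX_sq hXY h_mart
      (fun n k hk V hV hkV =>
        SpectralUniversality.indep_comp_toPNatPair hY_meas hY_indep hk hV hkV)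
      hYg h_bound h_mix h_lindeberg
    have hYlim : Tendsto (fun n => ∫ ω,
        (SpectralUniversality.integratedStieltjes n η t₀ t (fun p => Y' p ω) - κ) ^ 2 ∂μ) atTop
        (𝓝 0) := by
      refine SpectralUniversality.tendsto_integral_sq_of_tendsto_measure (hmeas hYm)
        (fun n ω => hbd n _) fun ε hε => ?_
      obtain ⟨ε₁, hε₁, h₁⟩ :=
        SpectralUniversality.exists_abs_cauchySmooth_sub_lt hF hη t (half_pos hε)
      obtain ⟨ε₀, hε₀, h₀⟩ :=
        SpectralUniversality.exists_abs_cauchySmooth_sub_lt hF hη t₀ (half_pos hε)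
      have hε' : 0 < min ε₁ ε₀ := lt_min hε₁ hε₀
      -- The threshold is halved because the complement of the event gives only `≤`, while the
      -- continuity estimates need a strict inequality.
      refine tendsto_of_tendsto_of_tendsto_of_le_of_le tendsto_const_nhds
        (hYF _ (half_pos hε')) (fun n => zero_le) fun n => measure_mono fun ω hω => ?_
      by_contra hlt
      have hlt' := not_lt.mp (Set.mem_ofPred_eq ▸ hlt)
      simp only [← hYesd] at hlt'
      have hmono := SpectralUniversality.esd_monotone n (fun i j => Y' ((i : ℤ), (j : ℤ)) ω)
      have h01 := SpectralUniversality.esd_mem_Icc n (fun i j => Y' ((i : ℤ), (j : ℤ)) ω)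
      have a₁ := h₁ _ hmono h01 (by linarith [min_le_left ε₁ ε₀])
      have a₀ := h₀ _ hmono h01 (by linarith [min_le_right ε₁ ε₀])
      have hω' : ε < |SpectralUniversality.integratedStieltjes n η t₀ t (fun p => Y' p ω) - κ| := hω
      rw [SpectralUniversality.integratedStieltjes_eq hη, hκ, sub_sub_sub_comm] at hω'
      have := (abs_sub _ _).trans_lt (add_lt_add a₁ a₀)
      linarith
    refine SpectralUniversality.tendsto_measure_of_tendsto_integral_sq (hmeas hXm)
      (fun n ω => hbd n _) ?_ hγ
    -- The mean square for `X` is the difference of the two plus the mean square for `Y`; both tend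
    -- to zero.
    simpa using hlim.add hYlim
  have hsum : Tendsto (fun n => ∑ t ∈ T, μ {ω | γ <
      |SpectralUniversality.integratedStieltjes n η t₀ t (fun p => X p ω) -
        (SpectralUniversality.cauchySmooth η F t - SpectralUniversality.cauchySmooth η F t₀)|})
      atTop (𝓝 0) := by
    simpa using tendsto_finsetSum T fun t _ => key t
  refine tendsto_of_tendsto_of_tendsto_of_le_of_le tendsto_const_nhds hsum
    (fun n => zero_le) fun n => ?_
  -- Union bound: a large Lévy distance forces a large deviation at some point of the finite set
  -- `T`.
  refine le_trans (measure_mono fun ω hω => ?_) (measure_biUnion_finset_le T _)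
  by_contra hnot
  simp only [Set.mem_iUnion, not_exists] at hnot
  refine absurd (hT _ (SpectralUniversality.esd_monotone n (fun i j => X ((i : ℤ), (j : ℤ)) ω))
    (SpectralUniversality.esd_mem_Icc n _) fun t ht => ?_) (not_le.mpr hω)
  have := not_lt.mp (Set.mem_ofPred_eq ▸ hnot t ht)
  rwa [SpectralUniversality.integratedStieltjes_eq hη] at this
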